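/- Let $A$ be a finite alphabet, let $A^{\mathbb N}=\{a(0)a(1)a(2)\cdots\}$ carry the product of the discrete topologies and its Borel $\sigma$-field, and let $T$ be the shift, $(Ta)(i)=a(i+1)$. Write $a(m:n)=a(m)\cdots a(n)$. Let $X\subset A^{\mathbb N}$ be a non-empty subshift (a compact set with $TX\subset X$). For $m\ge 0$ let $\mathcal L_m(X)=\{a(0:m): a\in X\}$ be the set of admissible words of length $m+1$, let $\mathcal L^*(X)=\bigcup_m\mathcal L_m(X)$, and for $p\geq 1$ let $\mathrm{Per}_p(X)=\{a\in X: T^pa=a\}$. For a subshift $Y$, $b\in Y$ and $n\ge 0$, let $[b(0:n)]=\{c\in Y: c(0:n)=b(0:n)\}$. Assume that $X$ is sofic, i.e. the collection of follower sets $\{u\in\mathcal L^*(X): wu\in\mathcal L^*(X)\}$, $w\in\mathcal L^*(X)$, is finite, and that $X$ is specified with specification length $\ell\geq 0$, i.e. for all $u\in\mathcal L_m(X)$, $v\in\mathcal L_n(X)$ and all $k,k'\ge \ell$ there is $c\in\mathrm{Per}_{m+n+k+k'+2}(X)$ with $c(0:m)=u$ and $(T^{m+k+1}c)(0:n)=v$.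 Let $\phi:A^{\mathbb N}\to\mathbb R$ be Hölder continuous: there are $C>0$ and $\theta\in[0,1)$ with $|\phi(a)-\phi(b)|\le C\theta^m$ whenever $m\ge 0$ and $a(0:m)=b(0:m)$. Put $S_n\phi=\sum_{i=0}^{n}\phi\circ T^i$. For a subshift $Y$, a $T$-invariant Borel probability measure $\mu$ on $Y$ is called a Gibbs measure for $\phi$ on $Y$ if there are constants $K>0$ and $P\in\mathbb R$ with $$K^{-1}\le\frac{\mu[a(0:n)]}{\exp(S_n\phi(a)-(n+1)P)}\le K\qquad\text{for all } n\ge 0,\ a\in Y.$$ For each $m\ge1$ there is exactly one Gibbs measure $\mu^m_\phi$ for $\phi$ on the subshift of finite type $X_m=\{a\in A^{\mathbb N}: a(j:j+m)\in\mathcal L_m(X)\ \forall j\ge 0\}$; as $m\to\infty$ the measures $\mu^m_\phi$ converge weakly to a $T$-invariant probability measure $\mu^*$ on $X$; the topological pressure $$P(\phi,X)=\lim_{k\to\infty}\frac1{k+1}\log\sum_{a\in \mathrm{Per}_{k+1}(X)}\exp(S_k\phi(a))$$ exists; and there is a constant $C_g>0$ such that $$C_g^{-1}\le\frac{\mu^*[a(0:n)]}{\exp\big(S_n\phi(a)-(n+1)P(\phi,X)\big)}\le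 C_g\qquad\text{for all } n\ge 0 \text{ and all } a\in X.$$ The constant $C_g$ can be chosen depending only on $A$, $\ell$, $C$, $\theta$ and (an upper bound for) $\|\phi\|=\sup|\phi|$. -/

import Mathlib

open MeasureTheory Filter Topology

namespace FTA

/-- The one-sided shift `T` on `A^ℕ` : `(T a)(i) = a(i+1)`. -/
def shift {A : Type*} (a : ℕ → A) : ℕ → A := fun i => a (i + 1)

/-- The word `a(m:n) = a(m) a(m+1) ⋯ a(n)` (for `m ≤ n`), of length `n - m + 1`. -/
def word {A : Type*} (a : ℕ → A) (m n : ℕ) : List A := (List.Ico m (n + 1)).map a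

/-- A subshift: a compact subset of `A^ℕ` that the shift maps into itself. -/
structure IsSubshift {A : Type*} [TopologicalSpace A] (X : Set (ℕ → A)) : Prop where
  isCompact : IsCompact X
  mapsTo : Set.MapsTo shift X X

/-- `𝓛_m(X)`: the `X`-admissible words of length `m + 1`. -/
def admissible {A : Type*} (X : Set (ℕ → A)) (m : ℕ) : Set (List A) :=
  {w | ∃ a ∈ X, word a 0 m = w}

/-- The language `𝓛^*(X) = ⋃ₙ 𝓛ₙ(X)`. -/
def language {A : Type*} (X : Set (ℕ → A)) : Set (List A) := ⋃ n, admissible X n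

/-- The set of followers of the word `w`. -/
def followers {A : Type*} (X : Set (ℕ → A)) (w : List A) : Set (List A) :=
  {u | u ∈ language X ∧ w ++ u ∈ language X}

/-- A (sub)shift is sofic if its admissible words have only finitely many follower sets. -/
def IsSofic {A : Type*} (X : Set (ℕ → A)) : Prop :=
  (followers X '' language X).Finite

/-- The sequences `a ∈ X` that are periodic of (not necessarily minimal) period `p`. -/
def periodicSeqs {A : Type*} (X : Set (ℕ → A)) (p : ℕ) : Set (ℕ → A) :=
  {a | a ∈ X ∧ shift^[p] a = a}

/-- `X` is specified with specification length `l`: for any two admissible words `u` and `v`, of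
lengths `m + 1` and `n + 1`, and any `k, k' ≥ l`, there is a periodic sequence in `X` whose
period is `u`, followed by `k` letters, followed by `v`, followed by `k'` letters. -/
def IsSpecified {A : Type*} (X : Set (ℕ → A)) (l : ℕ) : Prop :=
  ∀ m n : ℕ, ∀ u ∈ admissible X m, ∀ v ∈ admissible X n, ∀ k k' : ℕ, l ≤ k → l ≤ k' →
    ∃ c ∈ periodicSeqs X (m + n + k + k' + 2),
      word c 0 m = u ∧ word (shift^[m + k + 1] c) 0 n = v

/-- The finite type approximation `X_m` of order `m` to `X`. -/
def ftApprox {A : Type*} (X : Set (ℕ → A)) (m : ℕ) : Set (ℕ → A) :=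
  {a | ∀ j : ℕ, word a j (j + m) ∈ admissible X m}

/-- The cylinder of `X` determined by the word `a(0:n)`. -/
def cylinder {A : Type*} (X : Set (ℕ → A)) (a : ℕ → A) (n : ℕ) : Set (ℕ → A) :=
  {b | b ∈ X ∧ word b 0 n = word a 0 n}

/-- `φ` is Hölder continuous with constant `C > 0` and exponent `θ ∈ [0,1)`. -/
structure IsHolder {A : Type*} (φ : (ℕ → A) → ℝ) (C θ : ℝ) : Prop where
  const_pos : 0 < C
  exp_nonneg : 0 ≤ θ
  exp_lt_one : θ < 1
  bound : ∀ (m : ℕ) (a b : ℕ → A), word a 0 m = word b 0 m → |φ a - φ b| ≤ C * θ ^ m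

/-- `S_k φ = ∑_{i=0}^{k} φ ∘ T^i`. -/
noncomputable def ergodicSum {A : Type*} (φ : (ℕ → A) → ℝ) (k : ℕ) (a : ℕ → A) : ℝ :=
  ∑ i ∈ Finset.range (k + 1), φ (shift^[i] a)

/-- There are finitely many sequences of a given positive period, so that the finite sum over
them below is an actual sum. -/
theorem finite_periodicSeqs {A : Type*} [Finite A] (X : Set (ℕ → A)) (k : ℕ) :
    (periodicSeqs X (k + 1)).Finite := by
  have hs : ∀ (p : ℕ) (a : ℕ → A) (i : ℕ), (shift^[p] a) i = a (i + p) := by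
    intro p
    induction p with
    | zero => intro a i; rfl
    | succ p ih =>
      intro a i
      rw [Function.iterate_succ_apply, ih]
      simp [shift, add_assoc]
  refine Set.Finite.of_injOn (f := fun (a : ℕ → A) (i : Fin (k + 1)) => a i)
    (t := Set.univ) (fun _ _ => Set.mem_univ _) ?_ Set.finite_univ
  intro a ha b hb hab
  funext i
  induction i using Nat.strong_induction_on with
  | _ i ih =>
    by_cases h : i < k + 1
    · exact congrFun hab ⟨i, h⟩
    · obtain ⟨j, rfl⟩ : ∃ j, i = j + (k + 1) := ⟨i - (k + 1), by omega⟩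
      rw [← hs (k + 1) a j, ← hs (k + 1) b j, ha.2, hb.2]
      exact ih j (by omega)

/-- `P` is the topological pressure `P(φ,X)`, that is, the limit of
`(1/(k+1)) log ∑_{a ∈ Per_{k+1}(X)} exp (S_k φ(a))`. -/
def IsPressure {A : Type*} (φ : (ℕ → A) → ℝ) (X : Set (ℕ → A)) (P : ℝ) : Prop :=
  Tendsto (fun k : ℕ => 1 / ((k : ℝ) + 1) *
      Real.log (∑ᶠ a ∈ periodicSeqs X (k + 1), Real.exp (ergodicSum φ k a)))
    atTop (𝓝 P)

/-- The Gibbs inequality for `μ` on `X`, with constants `C` and `P`. -/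
def GibbsInequality {A : Type*} [MeasurableSpace A] (φ : (ℕ → A) → ℝ) (X : Set (ℕ → A))
    (μ : ProbabilityMeasure (ℕ → A)) (C P : ℝ) : Prop :=
  ∀ n : ℕ, ∀ a ∈ X,
    C⁻¹ ≤ (μ : Measure (ℕ → A)).real (cylinder X a n) /
        Real.exp (ergodicSum φ n a - ((n : ℝ) + 1) * P) ∧
      (μ : Measure (ℕ → A)).real (cylinder X a n) /
        Real.exp (ergodicSum φ n a - ((n : ℝ) + 1) * P) ≤ C

/-- `μ ∈ 𝓜_T(X)`: a shift-invariant Borel probability measure on `X` (regarded as a measure on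
`A^ℕ` that gives `X` full mass). -/
structure IsInvariantOn {A : Type*} [MeasurableSpace A] (X : Set (ℕ → A))
    (μ : ProbabilityMeasure (ℕ → A)) : Prop where
  measurePreserving : MeasurePreserving shift (μ : Measure (ℕ → A)) (μ : Measure (ℕ → A))
  full : (μ : Measure (ℕ → A)) X = 1

/-- `μ` is a Gibbs measure for the potential `φ` on the subshift `X`. -/
def IsGibbs {A : Type*} [MeasurableSpace A] (φ : (ℕ → A) → ℝ) (X : Set (ℕ → A))
    (μ : ProbabilityMeasure (ℕ → A)) : Prop :=
  IsInvariantOn X μ ∧ ∃ C P : ℝ, 0 < C ∧ GibbsInequality φ X μ C P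

end FTA

/-!
The argument is Bowen's: specification yields Gibbs measures, with uniform constants, and their
uniqueness.

Let `Y` be a closed shift-invariant set in which words can be concatenated across gaps of `l`
letters and closed up to periodic sequences (`FTA.HasGluing`), and let `Z_N` be the sum of
`exp (S_N φ)` over the words of length `N` of `Y`. Since the Birkhoff sums have bounded distortion,
cutting and concatenating words shows that `log Z_N` is additive up to an error which depends on
`A`, `l`, the Hölder data and the bound of `φ` only. Hence `|log Z_N - N P| ≤ κ` for some `P`
(`FTA.HasGluing.exists_pressure`). The same comparison, for the periodic sequences that start with
a given word (`FTA.HasGluing.eventually_periodicSum_bounds`), shows that `P` is the pressure and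
that the invariant measures carried by periodic sequences with weights `exp (S_k φ)` satisfy the
Gibbs bounds on each fixed cylinder once the period is large. A weak limit point of these measures
is a Gibbs measure with uniform constants (`FTA.HasGluing.exists_gibbs`).

A Gibbs measure gives the concatenation of two words at least a fixed proportion of the product of
their measures. This inequality extends from cylinders to all Borel sets, which forces ergodicity
(`FTA.HasGluing.ergodic`). Two Gibbs measures for `φ` on `Y` are mutually absolutely continuous,
hence equal (`FTA.HasGluing.gibbs_unique`).

If `X` is specified, all of this applies to `X` and, with the same `l`, to every approximation
`X_m` with `m ≥ 1` (`FTA.IsSpecified.hasGluing_ftApprox`). The measure `μ^*` is the Gibbs measure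
of `X`. As `X` and `X_m` have the same words up to length `m + 1`, their pressures differ by
`O(1 / m)`. So every weak limit point of the `μ^m` is a Gibbs measure on `X`, hence equal to `μ^*`,
and compactness of the space of probability measures gives convergence
(`FTA.tendsto_gibbs_ftApprox`).
-/

namespace FTA

/-! ### Words and Birkhoff sums -/

theorem iterate_shift_apply {A : Type*} (p : ℕ) (a : ℕ → A) (i : ℕ) :
    (shift^[p] a) i = a (p + i) := by
  induction p generalizing a with
  | zero => simp
  | succ p ih =>
    rw [Function.iterate_succ_apply, ih]
    simp only [shift]
    congr 1
    omega

/-- The sequence that agrees with `a` before time `N` and is constant from then on. It stands for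
the word formed by the first `N` letters of `a`: the value depends on these letters only. -/
noncomputable def truncate {A : Type*} [Nonempty A] (N : ℕ) (a : ℕ → A) : ℕ → A :=
  fun i => if i < N then a i else Classical.arbitrary A

theorem truncate_mem_cylinder {A : Type*} [Nonempty A] (N : ℕ) (a : ℕ → A) :
    truncate N a ∈ PiNat.cylinder a N := fun i hi => by simp [truncate, hi]

theorem truncate_eq_of_mem_cylinder {A : Type*} [Nonempty A] {N : ℕ} {a b : ℕ → A}
    (h : a ∈ PiNat.cylinder b N) : truncate N a = truncate N b := by
  funext i
  by_cases hi : i < N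
  · simp [truncate, hi, h i hi]
  · simp [truncate, hi]

theorem finite_image_truncate {A : Type*} [Nonempty A] [Finite A] (Y : Set (ℕ → A)) (N : ℕ) :
    (truncate N '' Y).Finite := by
  refine Set.Finite.of_injOn (f := fun (a : ℕ → A) (i : Fin N) => a i)
    (t := Set.univ) (fun _ _ => Set.mem_univ _) ?_ Set.finite_univ
  rintro _ ⟨a, -, rfl⟩ _ ⟨b, -, rfl⟩ h
  funext i
  by_cases hi : i < N
  · exact congrFun h ⟨i, hi⟩
  · simp [truncate, hi]

/-- The words of length `N` of `Y`, each of them represented by a truncated sequence. -/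
noncomputable def words {A : Type*} [Nonempty A] [Finite A] (Y : Set (ℕ → A)) (N : ℕ) :
    Finset (ℕ → A) := (finite_image_truncate Y N).toFinset

theorem mem_words {A : Type*} [Nonempty A] [Finite A] {Y : Set (ℕ → A)} {N : ℕ} {w : ℕ → A} :
    w ∈ words Y N ↔ ∃ y ∈ Y, truncate N y = w := by simp [words]

theorem eq_of_mem_words {A : Type*} [Nonempty A] [Finite A] {Y : Set (ℕ → A)} {N : ℕ}
    {v w : ℕ → A} (hv : v ∈ words Y N) (hw : w ∈ words Y N) (h : v ∈ PiNat.cylinder w N) :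
    v = w := by
  obtain ⟨a, -, rfl⟩ := mem_words.1 hv
  obtain ⟨b, -, rfl⟩ := mem_words.1 hw
  refine truncate_eq_of_mem_cylinder fun i hi => ?_
  rw [← truncate_mem_cylinder N a i hi, ← truncate_mem_cylinder N b i hi, h i hi]

theorem card_words_le {A : Type*} [Nonempty A] [Finite A] (Y : Set (ℕ → A)) (N : ℕ) :
    (words Y N).card ≤ Nat.card A ^ N := by
  have := Fintype.ofFinite A
  classical
  have h := Finset.card_le_card_of_injOn (s := words Y N) (t := Finset.univ)
    (fun (a : ℕ → A) (i : Fin N) => a i) (fun _ _ => Finset.mem_univ _)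
    (fun v hv w hw h => eq_of_mem_words hv hw fun i hi => congrFun h ⟨i, hi⟩)
  simpa [Nat.card_eq_fintype_card] using h

/-- The potential `φ` is bounded by `B`, and its Birkhoff sums of any length `N` vary by at most
`D` on the cylinders of length `N` (bounded distortion). -/
structure HasBoundedDistortion {A : Type*} (φ : (ℕ → A) → ℝ) (B D : ℝ) : Prop where
  bound : ∀ a, |φ a| ≤ B
  distortion : ∀ (N : ℕ) (a b : ℕ → A), a ∈ PiNat.cylinder b N →
    |birkhoffSum shift φ N a - birkhoffSum shift φ N b| ≤ D

theorem HasBoundedDistortion.birkhoffSum_le {A : Type*} {φ : (ℕ → A) → ℝ} {B D : ℝ}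
    (hφ : HasBoundedDistortion φ B D) {N : ℕ} {a b : ℕ → A} (h : a ∈ PiNat.cylinder b N) :
    birkhoffSum shift φ N a ≤ birkhoffSum shift φ N b + D := by
  have := (abs_le.1 (hφ.distortion N a b h)).2
  linarith

theorem HasBoundedDistortion.le_birkhoffSum {A : Type*} {φ : (ℕ → A) → ℝ} {B D : ℝ}
    (hφ : HasBoundedDistortion φ B D) {N : ℕ} {a b : ℕ → A} (h : a ∈ PiNat.cylinder b N) :
    birkhoffSum shift φ N b ≤ birkhoffSum shift φ N a + D := by
  have := (abs_le.1 (hφ.distortion N a b h)).1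
  linarith

theorem HasBoundedDistortion.abs_birkhoffSum_le {A : Type*} {φ : (ℕ → A) → ℝ} {B D : ℝ}
    (hφ : HasBoundedDistortion φ B D) (N : ℕ) (a : ℕ → A) :
    |birkhoffSum shift φ N a| ≤ N * B := by
  refine (Finset.abs_sum_le_sum_abs _ _).trans ?_
  refine (Finset.sum_le_sum fun i _ => hφ.bound _).trans ?_
  simp

theorem HasBoundedDistortion.nonneg {A : Type*} [Nonempty A] {φ : (ℕ → A) → ℝ} {B D : ℝ}
    (hφ : HasBoundedDistortion φ B D) : 0 ≤ B ∧ 0 ≤ D :=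
  ⟨(abs_nonneg _).trans (hφ.bound fun _ => Classical.arbitrary A),
    (abs_nonneg _).trans (hφ.distortion 0 (fun _ => Classical.arbitrary A) _
      (PiNat.self_mem_cylinder _ _))⟩

theorem IsHolder.hasBoundedDistortion {A : Type*} {φ : (ℕ → A) → ℝ} {B C θ : ℝ}
    (h : IsHolder φ C θ) (hB : ∀ a, |φ a| ≤ B) : HasBoundedDistortion φ B (C / (1 - θ)) := by
  refine ⟨hB, fun N a b hab => ?_⟩
  have hθ : 0 < 1 - θ := by linarith [h.exp_lt_one]
  have key : ∀ i ∈ Finset.range N,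
      |φ (shift^[i] a) - φ (shift^[i] b)| ≤ C * θ ^ (N - 1 - i) := by
    intro i hi
    have hi := Finset.mem_range.1 hi
    refine h.bound _ _ _ ?_
    refine List.map_congr_left fun j hj => ?_
    rw [List.Ico.mem] at hj
    rw [iterate_shift_apply, iterate_shift_apply]
    exact hab _ (by omega)
  calc |birkhoffSum shift φ N a - birkhoffSum shift φ N b|
      = |∑ i ∈ Finset.range N, (φ (shift^[i] a) - φ (shift^[i] b))| := by
        rw [Finset.sum_sub_distrib]; rfl
    _ ≤ ∑ i ∈ Finset.range N, C * θ ^ (N - 1 - i) :=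
        (Finset.abs_sum_le_sum_abs _ _).trans (Finset.sum_le_sum key)
    _ = C * ∑ i ∈ Finset.range N, θ ^ i := by
        rw [Finset.sum_range_reflect (fun i => C * θ ^ i) N, Finset.mul_sum]
    _ ≤ C * (1 / (1 - θ)) := by
        refine mul_le_mul_of_nonneg_left ?_ h.const_pos.le
        rw [geom_sum_eq h.exp_lt_one.ne, ← neg_div_neg_eq]
        rw [neg_sub, neg_sub]
        refine div_le_div_of_nonneg_right ?_ hθ.le
        have := pow_nonneg h.exp_nonneg N
        linarith
    _ = C / (1 - θ) := by ring

/-! ### Quasi-additivity of the partition function -/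

/-- The form of specification that the thermodynamic estimates use: admissible words can be
concatenated across a gap of exactly `l` letters, and the concatenation can be closed up to a
periodic sequence, again across a gap of `l` letters, as soon as the second word is long enough. -/
structure HasGluing {A : Type*} (Y : Set (ℕ → A)) (l : ℕ) : Prop where
  nonempty : Y.Nonempty
  mapsTo : Set.MapsTo shift Y Y
  glue : ∀ M N : ℕ, 1 ≤ M → 1 ≤ N → ∀ a ∈ Y, ∀ b ∈ Y, ∃ c ∈ Y,
    c ∈ PiNat.cylinder a M ∧ shift^[M + l] c ∈ PiNat.cylinder b N
  close : ∃ N₀ : ℕ, ∀ M N : ℕ, 1 ≤ M → N₀ ≤ N → ∀ a ∈ Y, ∀ b ∈ Y, ∃ c ∈ Y,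
    shift^[M + l + N + l] c = c ∧
    c ∈ PiNat.cylinder a M ∧ shift^[M + l] c ∈ PiNat.cylinder b N

/-- The partition function of order `N`: the sum of `exp (S_N φ)` over the words of length `N`. -/
noncomputable def partitionFunction {A : Type*} [Nonempty A] [Finite A] (φ : (ℕ → A) → ℝ)
    (Y : Set (ℕ → A)) (N : ℕ) : ℝ :=
  ∑ w ∈ words Y N, Real.exp (birkhoffSum shift φ N w)

/-- Comparison of two sums along a relation under which every term of the first sum is dominated
by a term of the second one, different terms by different terms. -/
theorem sum_le_sum_of_relation {ι κ : Type*} {s : Finset ι} {t : Finset κ} {f : ι → ℝ} {g : κ → ℝ}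
    (R : ι → κ → Prop) (h : ∀ x ∈ s, ∃ y ∈ t, R x y ∧ f x ≤ g y)
    (hR : ∀ x ∈ s, ∀ x' ∈ s, ∀ y, R x y → R x' y → x = x') (hg : ∀ y ∈ t, 0 ≤ g y) :
    ∑ x ∈ s, f x ≤ ∑ y ∈ t, g y := by
  classical
  rcases s.eq_empty_or_nonempty with rfl | ⟨x₀, hx₀⟩
  · simpa using Finset.sum_nonneg hg
  have : Nonempty κ := ⟨(h x₀ hx₀).choose⟩
  choose! e he using h
  have inj : Set.InjOn e s := fun x hx x' hx' hxx =>
    hR x hx x' hx' (e x) (he x hx).2.1 (hxx ▸ (he x' hx').2.1)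
  calc ∑ x ∈ s, f x ≤ ∑ x ∈ s, g (e x) := Finset.sum_le_sum fun x hx => (he x hx).2.2
    _ = ∑ y ∈ s.image e, g y := (Finset.sum_image inj).symm
    _ ≤ ∑ y ∈ t, g y := by
        refine Finset.sum_le_sum_of_subset_of_nonneg ?_ fun y hy _ => hg y hy
        intro y hy
        obtain ⟨x, hx, rfl⟩ := Finset.mem_image.1 hy
        exact (he x hx).1

theorem partitionFunction_pos {A : Type*} [Nonempty A] [Finite A] (φ : (ℕ → A) → ℝ)
    {Y : Set (ℕ → A)} (hY : Y.Nonempty) (N : ℕ) : 0 < partitionFunction φ Y N := by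
  obtain ⟨y, hy⟩ := hY
  exact Finset.sum_pos (fun _ _ => Real.exp_pos _) ⟨_, mem_words.2 ⟨y, hy, rfl⟩⟩

theorem partitionFunction_zero {A : Type*} [Nonempty A] [Finite A] (φ : (ℕ → A) → ℝ)
    {Y : Set (ℕ → A)} (hY : Y.Nonempty) : partitionFunction φ Y 0 = 1 := by
  obtain ⟨y, hy⟩ := hY
  have : words Y 0 = {truncate 0 y} := by
    refine Finset.eq_singleton_iff_unique_mem.2 ⟨mem_words.2 ⟨y, hy, rfl⟩, fun w hw => ?_⟩
    exact eq_of_mem_words hw (mem_words.2 ⟨y, hy, rfl⟩) (by simp)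
  simp [partitionFunction, this]

theorem partitionFunction_le {A : Type*} [Nonempty A] [Finite A] {φ : (ℕ → A) → ℝ} {B D : ℝ}
    (hφ : HasBoundedDistortion φ B D) (Y : Set (ℕ → A)) (N : ℕ) :
    partitionFunction φ Y N ≤ Real.exp (N * (B + Real.log (Nat.card A))) := by
  have hA : (0 : ℝ) < Nat.card A := by exact_mod_cast Nat.card_pos
  have h1 : partitionFunction φ Y N ≤ (words Y N).card • Real.exp (N * B) :=
    Finset.sum_le_card_nsmul _ _ _ fun w _ =>
      Real.exp_le_exp.2 (abs_le.1 (hφ.abs_birkhoffSum_le N w)).2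
  have h2 : ((words Y N).card : ℝ) ≤ (Nat.card A : ℝ) ^ N := by
    exact_mod_cast card_words_le Y N
  rw [nsmul_eq_mul] at h1
  refine h1.trans ((mul_le_mul_of_nonneg_right h2 (Real.exp_pos _).le).trans_eq ?_)
  rw [mul_add, Real.exp_add, mul_comm, Real.exp_nat_mul (Real.log _), Real.exp_log hA]

theorem partitionFunction_add_le {A : Type*} [Nonempty A] [Finite A] {φ : (ℕ → A) → ℝ} {B D : ℝ}
    (hφ : HasBoundedDistortion φ B D) {Y : Set (ℕ → A)} (hY : Set.MapsTo shift Y Y) (M N : ℕ) :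
    partitionFunction φ Y (M + N) ≤
      Real.exp (2 * D) * (partitionFunction φ Y M * partitionFunction φ Y N) := by
  rw [partitionFunction, partitionFunction, partitionFunction, Finset.sum_mul_sum,
    ← Finset.sum_product', Finset.mul_sum]
  refine sum_le_sum_of_relation
    (fun w p => p.1 ∈ PiNat.cylinder w M ∧ p.2 ∈ PiNat.cylinder (shift^[M] w) N) ?_ ?_
    (fun _ _ => by positivity)
  · intro w hw
    obtain ⟨y, hy, rfl⟩ := mem_words.1 hw
    have h1 : truncate M y ∈ PiNat.cylinder (truncate (M + N) y) M := fun i hi => by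
      simp [truncate, hi, show i < M + N by omega]
    have h2 : truncate N (shift^[M] y) ∈ PiNat.cylinder (shift^[M] (truncate (M + N) y)) N :=
      fun i hi => by simp [truncate, hi, iterate_shift_apply]
    refine ⟨(truncate M y, truncate N (shift^[M] y)), Finset.mem_product.2
      ⟨mem_words.2 ⟨y, hy, rfl⟩, mem_words.2 ⟨_, hY.iterate M hy, rfl⟩⟩, ⟨h1, h2⟩, ?_⟩
    rw [← Real.exp_add, ← Real.exp_add, Real.exp_le_exp, birkhoffSum_add]
    have := hφ.le_birkhoffSum h1
    have := hφ.le_birkhoffSum h2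
    linarith
  · rintro w hw w' hw' ⟨u, v⟩ ⟨h1, h2⟩ ⟨h1', h2'⟩
    refine eq_of_mem_words hw hw' fun i hi => ?_
    by_cases hM : i < M
    · exact (h1 i hM).symm.trans (h1' i hM)
    · have e := (h2 (i - M) (by omega)).symm.trans (h2' (i - M) (by omega))
      rwa [iterate_shift_apply, iterate_shift_apply, Nat.add_sub_cancel' (by omega)] at e

theorem HasGluing.mul_partitionFunction_le {A : Type*} [Nonempty A] [Finite A]
    {φ : (ℕ → A) → ℝ} {B D : ℝ} (hφ : HasBoundedDistortion φ B D) {Y : Set (ℕ → A)} {l : ℕ}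
    (hY : HasGluing Y l) {M N : ℕ} (hM : 1 ≤ M) (hN : 1 ≤ N) :
    partitionFunction φ Y M * partitionFunction φ Y N ≤
      Real.exp (3 * D + l * B) * partitionFunction φ Y (M + l + N) := by
  rw [partitionFunction, partitionFunction, partitionFunction, Finset.sum_mul_sum,
    ← Finset.sum_product', Finset.mul_sum]
  refine sum_le_sum_of_relation
    (fun p w => p.1 ∈ PiNat.cylinder w M ∧ p.2 ∈ PiNat.cylinder (shift^[M + l] w) N) ?_ ?_
    (fun _ _ => by positivity)
  · rintro ⟨u, v⟩ hp
    obtain ⟨hu, hv⟩ := Finset.mem_product.1 hp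
    obtain ⟨a, ha, rfl⟩ := mem_words.1 hu
    obtain ⟨b, hb, rfl⟩ := mem_words.1 hv
    obtain ⟨c, hc, h1, h2⟩ := hY.glue M N hM hN a ha b hb
    have k1 : truncate M a ∈ PiNat.cylinder (truncate (M + l + N) c) M := fun i hi => by
      simp [truncate, hi, show i < M + l + N by omega, h1 i hi]
    have k2 : truncate N b ∈ PiNat.cylinder (shift^[M + l] (truncate (M + l + N) c)) N :=
      fun i hi => by
        have := h2 i hi
        rw [iterate_shift_apply] at this
        simp [truncate, hi, iterate_shift_apply, this]
    refine ⟨_, mem_words.2 ⟨c, hc, rfl⟩, ⟨k1, k2⟩, ?_⟩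
    rw [← Real.exp_add, ← Real.exp_add, Real.exp_le_exp, birkhoffSum_add, birkhoffSum_add]
    have := hφ.birkhoffSum_le k1
    have := hφ.birkhoffSum_le k2
    have := (abs_le.1 (hφ.abs_birkhoffSum_le l (shift^[M] (truncate (M + l + N) c)))).1
    have := hφ.nonneg.2
    dsimp only
    linarith
  · rintro ⟨u, v⟩ hp ⟨u', v'⟩ hp' w ⟨h1, h2⟩ ⟨h1', h2'⟩
    obtain ⟨hu, hv⟩ := Finset.mem_product.1 hp
    obtain ⟨hu', hv'⟩ := Finset.mem_product.1 hp'
    refine Prod.ext (eq_of_mem_words hu hu' fun i hi => ?_) (eq_of_mem_words hv hv' fun i hi => ?_)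
    · exact (h1 i hi).trans (h1' i hi).symm
    · exact (h2 i hi).trans (h2' i hi).symm

/-- A sequence of real numbers that is additive up to a bounded error is linear up to the same
error. This is Fekete's lemma, applied to `f + κ` and to `κ - f`. -/
theorem exists_forall_abs_sub_mul_le {f : ℕ → ℝ} {κ : ℝ}
    (h : ∀ M N, |f (M + N) - f M - f N| ≤ κ) : ∃ P : ℝ, ∀ N : ℕ, |f N - N * P| ≤ κ := by
  have h' := fun M N => abs_le.1 (h M N)
  have hκ : 0 ≤ κ := (abs_nonneg _).trans (h 0 0)
  have h0 : |f 0| ≤ κ := by simpa using h 0 0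
  have hlin : ∀ N : ℕ, |f N - N * f 1| ≤ (N + 1) * κ := by
    intro N
    induction N with
    | zero => simpa using h0
    | succ N ih =>
      have e1 := abs_le.1 ih
      have e2 := h' N 1
      rw [abs_le]
      push_cast
      constructor <;> linarith [e1.1, e1.2, e2.1, e2.2]
  have hu : Subadditive fun n => f n + κ := fun m n => by linarith [(h' m n).2]
  have hv : Subadditive fun n => κ - f n := fun m n => by linarith [(h' m n).1]
  have hub : BddBelow (Set.range fun n : ℕ => (f n + κ) / n) := by
    refine ⟨-|f 1| - κ, ?_⟩
    rintro _ ⟨n, rfl⟩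
    rcases Nat.eq_zero_or_pos n with rfl | hn
    · have := abs_nonneg (f 1)
      simp only [Nat.cast_zero, div_zero]
      linarith
    have hn' : (0 : ℝ) < n := by exact_mod_cast hn
    rw [le_div_iff₀ hn']
    have := mul_le_mul_of_nonneg_right (neg_abs_le (f 1)) hn'.le
    have := (abs_le.1 (hlin n)).1
    linarith
  have hvb : BddBelow (Set.range fun n : ℕ => (κ - f n) / n) := by
    refine ⟨-|f 1| - κ, ?_⟩
    rintro _ ⟨n, rfl⟩
    rcases Nat.eq_zero_or_pos n with rfl | hn
    · have := abs_nonneg (f 1)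
      simp only [Nat.cast_zero, div_zero]
      linarith
    have hn' : (0 : ℝ) < n := by exact_mod_cast hn
    rw [le_div_iff₀ hn']
    have := mul_le_mul_of_nonneg_right (le_abs_self (f 1)) hn'.le
    have := (abs_le.1 (hlin n)).2
    linarith
  have hlim : hv.lim = -hu.lim := by
    have t1 := hu.tendsto_lim hub
    have t2 := hv.tendsto_lim hvb
    have t3 : Tendsto (fun n : ℕ => 2 * κ / (n : ℝ)) atTop (𝓝 0) :=
      tendsto_const_div_atTop_nhds_zero_nat _
    have t4 := t3.sub t1
    rw [zero_sub] at t4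
    refine tendsto_nhds_unique t2 (t4.congr fun n => ?_)
    ring
  refine ⟨hu.lim, fun N => ?_⟩
  rcases Nat.eq_zero_or_pos N with rfl | hN
  · simpa using h0
  have hN' : (0 : ℝ) < N := by exact_mod_cast hN
  have l1 := hu.lim_le_div hub hN.ne'
  have l2 := hv.lim_le_div hvb hN.ne'
  rw [le_div_iff₀ hN'] at l1 l2
  rw [hlim] at l2
  rw [abs_le]
  constructor <;> linarith

/-- The constant `5 D + 2 l (B + log |A|)`, which bounds the error in `log Z_N ≈ N P`. -/
noncomputable def gluingConst (A : Type*) (l : ℕ) (B D : ℝ) : ℝ :=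
  5 * D + 2 * l * (B + Real.log (Nat.card A))

theorem HasGluing.abs_log_partitionFunction_add_le {A : Type*} [Nonempty A] [Finite A]
    {φ : (ℕ → A) → ℝ} {B D : ℝ} (hφ : HasBoundedDistortion φ B D) {Y : Set (ℕ → A)} {l : ℕ}
    (hY : HasGluing Y l) (M N : ℕ) :
    |Real.log (partitionFunction φ Y (M + N)) - Real.log (partitionFunction φ Y M) -
      Real.log (partitionFunction φ Y N)| ≤ gluingConst A l B D := by
  obtain ⟨hB, hD⟩ := hφ.nonneg
  have hL : 0 ≤ Real.log (Nat.card A) := Real.log_natCast_nonneg _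
  have hl : (0 : ℝ) ≤ l * (B + Real.log (Nat.card A)) := by positivity
  have pos := partitionFunction_pos φ hY.nonempty
  rw [abs_le, gluingConst]
  constructor
  · rcases Nat.eq_zero_or_pos M with rfl | hM
    · simp [partitionFunction_zero φ hY.nonempty]
      linarith
    rcases Nat.eq_zero_or_pos N with rfl | hN
    · simp [partitionFunction_zero φ hY.nonempty]
      linarith
    have e1 := hY.mul_partitionFunction_le hφ hM hN
    have e2 := partitionFunction_add_le hφ hY.mapsTo (M + N) l
    rw [show M + N + l = M + l + N by omega] at e2
    have e3 := partitionFunction_le hφ Y l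
    have e4 : partitionFunction φ Y M * partitionFunction φ Y N ≤
        Real.exp (3 * D + l * B) * (Real.exp (2 * D) * (partitionFunction φ Y (M + N) *
          Real.exp (l * (B + Real.log (Nat.card A))))) := by
      refine e1.trans (mul_le_mul_of_nonneg_left (e2.trans ?_) (Real.exp_pos _).le)
      gcongr
      exact (pos _).le
    have e5 := Real.log_le_log (mul_pos (pos M) (pos N)) e4
    rw [Real.log_mul (pos M).ne' (pos N).ne', Real.log_mul (by positivity)
      (by have := pos (M + N); positivity), Real.log_mul (by positivity)
      (by have := pos (M + N); positivity), Real.log_mul (pos _).ne' (by positivity),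
      Real.log_exp, Real.log_exp, Real.log_exp] at e5
    have : (0 : ℝ) ≤ l * Real.log (Nat.card A) := by positivity
    linarith
  · have e2 := Real.log_le_log (pos _) (partitionFunction_add_le hφ hY.mapsTo M N)
    rw [Real.log_mul (by positivity) (mul_pos (pos M) (pos N)).ne',
      Real.log_mul (pos M).ne' (pos N).ne', Real.log_exp] at e2
    linarith

/-- The numbers `log Z_N` grow linearly, up to a bounded error. The rate `P` is unique, hence it
is the pressure, which is also the growth rate of the sums over periodic sequences. -/
theorem HasGluing.exists_pressure {A : Type*} [Nonempty A] [Finite A]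
    {φ : (ℕ → A) → ℝ} {B D : ℝ} (hφ : HasBoundedDistortion φ B D) {Y : Set (ℕ → A)} {l : ℕ}
    (hY : HasGluing Y l) : ∃ P : ℝ, ∀ N : ℕ,
      |Real.log (partitionFunction φ Y N) - N * P| ≤ gluingConst A l B D :=
  exists_forall_abs_sub_mul_le (hY.abs_log_partitionFunction_add_le hφ)

/-! ### Sums over periodic sequences -/

theorem eq_of_periodic_of_mem_cylinder {A : Type*} {p : ℕ} (hp : 0 < p) {a b : ℕ → A}
    (ha : shift^[p] a = a) (hb : shift^[p] b = b) (h : a ∈ PiNat.cylinder b p) : a = b := by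
  funext i
  induction i using Nat.strong_induction_on with
  | _ i ih =>
    by_cases hi : i < p
    · exact h i hi
    · have e := ih (i - p) (by omega)
      rwa [← ha, ← hb, iterate_shift_apply, iterate_shift_apply,
        Nat.add_sub_cancel' (by omega)] at e

open Classical in
/-- The part of the sum over the sequences in `Y` of period `k + 1` that comes from the sequences
starting with the first `M` letters of `a`. -/
noncomputable def periodicSum {A : Type*} [Finite A] (φ : (ℕ → A) → ℝ)
    (Y : Set (ℕ → A)) (k : ℕ) (a : ℕ → A) (M : ℕ) : ℝ :=
  ∑ c ∈ (finite_periodicSeqs Y k).toFinset with c ∈ PiNat.cylinder a M,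
    Real.exp (birkhoffSum shift φ (k + 1) c)

theorem periodicSum_zero {A : Type*} [Finite A] (φ : (ℕ → A) → ℝ)
    (Y : Set (ℕ → A)) (k : ℕ) (a : ℕ → A) :
    periodicSum φ Y k a 0 =
      ∑ c ∈ (finite_periodicSeqs Y k).toFinset, Real.exp (birkhoffSum shift φ (k + 1) c) := by
  simp [periodicSum]

theorem periodicSum_le_zero {A : Type*} [Finite A] (φ : (ℕ → A) → ℝ)
    (Y : Set (ℕ → A)) (k : ℕ) (a : ℕ → A) (M : ℕ) :
    periodicSum φ Y k a M ≤ periodicSum φ Y k a 0 := by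
  classical
  rw [periodicSum_zero]
  exact Finset.sum_le_sum_of_subset_of_nonneg (Finset.filter_subset _ _)
    fun _ _ _ => (Real.exp_pos _).le

theorem periodicSum_le_mul_partitionFunction {A : Type*} [Nonempty A] [Finite A]
    {φ : (ℕ → A) → ℝ} {B D : ℝ} (hφ : HasBoundedDistortion φ B D) {Y : Set (ℕ → A)}
    (hY : Set.MapsTo shift Y Y) (a : ℕ → A) {k M N : ℕ} (hk : k + 1 = M + N) :
    periodicSum φ Y k a M ≤
      Real.exp (2 * D + birkhoffSum shift φ M a) * partitionFunction φ Y N := by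
  classical
  rw [periodicSum, partitionFunction, Finset.mul_sum]
  refine sum_le_sum_of_relation (fun c w => w ∈ PiNat.cylinder (shift^[M] c) N) ?_ ?_
    (fun _ _ => by positivity)
  · intro c hc
    obtain ⟨hc, hca⟩ := Finset.mem_filter.1 hc
    have hc := (Set.Finite.mem_toFinset _).1 hc
    have h := truncate_mem_cylinder N (shift^[M] c)
    refine ⟨_, mem_words.2 ⟨_, hY.iterate M hc.1, rfl⟩, h, ?_⟩
    rw [← Real.exp_add, Real.exp_le_exp, hk, birkhoffSum_add]
    have := hφ.birkhoffSum_le hca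
    have := hφ.le_birkhoffSum h
    linarith
  · intro c hc c' hc' w h h'
    obtain ⟨hc, hca⟩ := Finset.mem_filter.1 hc
    obtain ⟨hc', hca'⟩ := Finset.mem_filter.1 hc'
    have hc := (Set.Finite.mem_toFinset _).1 hc
    have hc' := (Set.Finite.mem_toFinset _).1 hc'
    refine eq_of_periodic_of_mem_cylinder k.succ_pos hc.2 hc'.2 fun i hi => ?_
    by_cases hM : i < M
    · exact (hca i hM).trans (hca' i hM).symm
    · have e := (h (i - M) (by omega)).symm.trans (h' (i - M) (by omega))
      rwa [iterate_shift_apply, iterate_shift_apply, Nat.add_sub_cancel' (by omega)] at e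

theorem HasGluing.mul_partitionFunction_le_periodicSum {A : Type*} [Nonempty A] [Finite A]
    {φ : (ℕ → A) → ℝ} {B D : ℝ} (hφ : HasBoundedDistortion φ B D) {Y : Set (ℕ → A)} {l : ℕ}
    (hY : HasGluing Y l) : ∃ N₀ : ℕ, ∀ k M N : ℕ, 1 ≤ M → N₀ ≤ N → k + 1 = M + l + N + l →
      ∀ a ∈ Y, Real.exp (birkhoffSum shift φ M a - 2 * D - 2 * l * B) * partitionFunction φ Y N ≤
        periodicSum φ Y k a M := by
  obtain ⟨N₀, h₀⟩ := hY.close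
  refine ⟨N₀, fun k M N hM hN hk a ha => ?_⟩
  classical
  rw [periodicSum, partitionFunction, Finset.mul_sum]
  refine sum_le_sum_of_relation (fun w c => shift^[M + l] c ∈ PiNat.cylinder w N) ?_ ?_
    (fun _ _ => by positivity)
  · intro w hw
    obtain ⟨b, hb, rfl⟩ := mem_words.1 hw
    obtain ⟨c, hc, hper, h1, h2⟩ := h₀ M N hM hN a ha b hb
    have h2' : shift^[M + l] c ∈ PiNat.cylinder (truncate N b) N := fun i hi =>
      (h2 i hi).trans (truncate_mem_cylinder N b i hi).symm
    refine ⟨c, Finset.mem_filter.2 ⟨(Set.Finite.mem_toFinset _).2 ⟨hc, hk ▸ hper⟩, h1⟩, h2', ?_⟩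
    rw [← Real.exp_add, Real.exp_le_exp, hk, birkhoffSum_add, birkhoffSum_add, birkhoffSum_add]
    have := hφ.le_birkhoffSum h1
    have := hφ.le_birkhoffSum h2'
    have := (abs_le.1 (hφ.abs_birkhoffSum_le l (shift^[M] c))).1
    have := (abs_le.1 (hφ.abs_birkhoffSum_le l (shift^[M + l + N] c))).1
    linarith
  · intro w hw w' hw' c h h'
    exact eq_of_mem_words hw hw' fun i hi => (h i hi).symm.trans (h' i hi)

/-- The constant that bounds the errors in all comparisons of sums over periodic sequences with
their expected sizes. -/
noncomputable def periodicConst (A : Type*) (l : ℕ) (B D : ℝ) : ℝ :=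
  2 * D + 2 * l * B + B + gluingConst A l B D +
    (2 * l + 1) * (B + Real.log (Nat.card A) + gluingConst A l B D)

theorem HasGluing.eventually_periodicSum_bounds {A : Type*} [Nonempty A] [Finite A]
    {φ : (ℕ → A) → ℝ} {B D : ℝ} (hφ : HasBoundedDistortion φ B D) {Y : Set (ℕ → A)} {l : ℕ}
    (hY : HasGluing Y l) {P : ℝ}
    (hP : ∀ N : ℕ, |Real.log (partitionFunction φ Y N) - N * P| ≤ gluingConst A l B D)
    (M : ℕ) {a : ℕ → A} (ha : a ∈ Y) : ∀ᶠ k : ℕ in atTop,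
      Real.exp (-periodicConst A l B D + birkhoffSum shift φ M a + ((k : ℝ) + 1 - M) * P) ≤
        periodicSum φ Y k a M ∧
      periodicSum φ Y k a M ≤
        Real.exp (periodicConst A l B D + birkhoffSum shift φ M a + ((k : ℝ) + 1 - M) * P) := by
  obtain ⟨hB, hD⟩ := hφ.nonneg
  have hL : 0 ≤ Real.log (Nat.card A) := Real.log_natCast_nonneg _
  have hκ : 0 ≤ gluingConst A l B D := by
    unfold gluingConst
    positivity
  set κ := gluingConst A l B D with hκdef
  set L := Real.log (Nat.card A) with hLdef
  have pos := partitionFunction_pos φ hY.nonempty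
  have hPup : P ≤ B + L + κ := by
    have e1 := (abs_le.1 (hP 1)).1
    have e2 := Real.log_le_log (pos 1) (partitionFunction_le hφ Y 1)
    rw [Real.log_exp] at e2
    push_cast at e1 e2
    linarith
  have hl0 : (0 : ℝ) ≤ l := l.cast_nonneg
  have h2lP : 2 * l * P ≤ 2 * l * (B + L + κ) := by gcongr
  have h2l : 0 ≤ 2 * l * (B + L + κ) := by positivity
  have hlB : 0 ≤ 2 * l * B := by positivity
  have lower : ∀ M : ℕ, 1 ≤ M → ∀ᶠ k : ℕ in atTop,
      Real.exp (-(2 * D + 2 * l * B + κ + 2 * l * (B + L + κ)) + birkhoffSum shift φ M a +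
        ((k : ℝ) + 1 - M) * P) ≤ periodicSum φ Y k a M := by
    intro M hM
    obtain ⟨N₀, h₀⟩ := hY.mul_partitionFunction_le_periodicSum hφ
    filter_upwards [eventually_ge_atTop (M + l + N₀ + l)] with k hk
    obtain ⟨N, hN⟩ : ∃ N, k + 1 = M + l + N + l := ⟨k + 1 - M - l - l, by omega⟩
    refine le_trans ?_ (h₀ k M N hM (by omega) hN a ha)
    rw [← Real.exp_log (pos N), ← Real.exp_add, Real.exp_le_exp]
    have e1 := (abs_le.1 (hP N)).1
    have e2 : (k : ℝ) + 1 = M + l + N + l := by exact_mod_cast hN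
    rw [e2]
    linarith
  filter_upwards [lower (max M 1) (le_max_right _ _), eventually_ge_atTop M] with k hk hkM
  constructor
  · rcases Nat.eq_zero_or_pos M with rfl | hM
    · -- The whole sum is bounded below by its part over a cylinder of length one.
      refine le_trans ?_ (hk.trans (periodicSum_le_zero _ _ _ _ _))
      rw [Real.exp_le_exp, birkhoffSum_zero, max_eq_right zero_le_one, birkhoffSum_one,
        periodicConst]
      have := (abs_le.1 (hφ.bound a)).1
      push_cast
      linarith
    · rw [max_eq_left hM] at hk
      refine le_trans ?_ hk
      rw [Real.exp_le_exp, periodicConst]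
      linarith
  · obtain ⟨N, hN⟩ : ∃ N, k + 1 = M + N := ⟨k + 1 - M, by omega⟩
    refine (periodicSum_le_mul_partitionFunction hφ hY.mapsTo a hN).trans ?_
    rw [← Real.exp_log (pos N), ← Real.exp_add, Real.exp_le_exp, periodicConst]
    have e1 := (abs_le.1 (hP N)).2
    have e2 : (k : ℝ) + 1 = M + N := by exact_mod_cast hN
    rw [e2]
    linarith

theorem HasGluing.isPressure {A : Type*} [Nonempty A] [Finite A]
    {φ : (ℕ → A) → ℝ} {B D : ℝ} (hφ : HasBoundedDistortion φ B D) {Y : Set (ℕ → A)} {l : ℕ}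
    (hY : HasGluing Y l) {P : ℝ}
    (hP : ∀ N : ℕ, |Real.log (partitionFunction φ Y N) - N * P| ≤ gluingConst A l B D) :
    IsPressure φ Y P := by
  obtain ⟨a, ha⟩ := hY.nonempty
  set H := periodicConst A l B D
  have hlim : Tendsto (fun k : ℕ => H / ((k : ℝ) + 1)) atTop (𝓝 0) := by
    simpa [Function.comp_def] using
      (tendsto_const_div_atTop_nhds_zero_nat H).comp (tendsto_add_atTop_nat 1)
  refine tendsto_iff_dist_tendsto_zero.2 (squeeze_zero' (Eventually.of_forall fun _ =>
    dist_nonneg) ?_ hlim)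
  filter_upwards [hY.eventually_periodicSum_bounds hφ hP 0 ha] with k hk
  have e : ∑ᶠ c ∈ periodicSeqs Y (k + 1), Real.exp (ergodicSum φ k c) = periodicSum φ Y k a 0 := by
    rw [finsum_mem_eq_finite_toFinset_sum _ (finite_periodicSeqs Y k), periodicSum_zero]
    rfl
  have hk0 : (0 : ℝ) < (k : ℝ) + 1 := by positivity
  have hpos := (Real.exp_pos _).trans_le hk.1
  have e1 := Real.log_le_log (Real.exp_pos _) hk.1
  have e2 := Real.log_le_log hpos hk.2
  rw [Real.log_exp] at e1 e2
  rw [birkhoffSum_zero, Nat.cast_zero, sub_zero] at e1 e2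
  rw [e, Real.dist_eq, show 1 / ((k : ℝ) + 1) * Real.log (periodicSum φ Y k a 0) - P =
    (Real.log (periodicSum φ Y k a 0) - ((k : ℝ) + 1) * P) / ((k : ℝ) + 1) by field_simp,
    abs_div, abs_of_pos hk0]
  refine div_le_div_of_nonneg_right (abs_le.2 ⟨?_, ?_⟩) hk0.le <;> linarith

/-! ### Measures and cylinders -/

theorem isClopen_piNatCylinder {A : Type*} [TopologicalSpace A] [DiscreteTopology A]
    (a : ℕ → A) (N : ℕ) : IsClopen (PiNat.cylinder a N) := by
  refine ⟨?_, PiNat.isOpen_cylinder _ a N⟩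
  rw [PiNat.cylinder_eq_pi]
  exact isClosed_set_pi fun _ _ => isClosed_singleton

theorem exists_cylinder_subset {A : Type*} [TopologicalSpace A] [DiscreteTopology A]
    {U : Set (ℕ → A)} (hU : IsOpen U) {a : ℕ → A} (ha : a ∈ U) :
    ∃ N, PiNat.cylinder a N ⊆ U := by
  obtain ⟨_, ⟨b, N, rfl⟩, hab, hbU⟩ :=
    (PiNat.isTopologicalBasis_cylinders fun _ => A).exists_subset_of_mem_open ha hU
  exact ⟨N, (PiNat.mem_cylinder_iff_eq.1 hab).trans_subset hbU⟩

theorem continuous_shift {A : Type*} [TopologicalSpace A] : Continuous (shift : (ℕ → A) → ℕ → A) :=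
  continuous_pi fun i => continuous_apply (i + 1)

theorem measure_le_of_piNatCylinder_subset {A : Type*} [Finite A] [Nonempty A]
    [TopologicalSpace A] [DiscreteTopology A] [MeasurableSpace A] [BorelSpace A]
    {μ ν : Measure (ℕ → A)} {N : ℕ}
    (h : ∀ w, μ (PiNat.cylinder w N) ≤ ν (PiNat.cylinder w N)) {S : Set (ℕ → A)}
    (hS : ∀ a ∈ S, PiNat.cylinder a N ⊆ S) : μ S ≤ ν S := by
  have hU : S = ⋃ w ∈ words S N, PiNat.cylinder w N := by
    ext a
    simp only [Set.mem_iUnion, exists_prop]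
    constructor
    · exact fun ha => ⟨_, mem_words.2 ⟨a, ha, rfl⟩,
        (PiNat.mem_cylinder_comm _ _ _).1 (truncate_mem_cylinder N a)⟩
    · rintro ⟨w, hw, haw⟩
      obtain ⟨b, hb, rfl⟩ := mem_words.1 hw
      exact hS b hb fun i hi => (haw i hi).trans (truncate_mem_cylinder N b i hi)
  have hd : (words S N : Set (ℕ → A)).PairwiseDisjoint fun w => PiNat.cylinder w N := by
    intro v hv w hw hvw
    refine Set.disjoint_left.2 fun a hav haw => hvw (eq_of_mem_words hv hw fun i hi => ?_)
    exact (hav i hi).symm.trans (haw i hi)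
  calc μ S = μ (⋃ w ∈ words S N, PiNat.cylinder w N) := by rw [← hU]
    _ ≤ ∑ w ∈ words S N, μ (PiNat.cylinder w N) := measure_biUnion_finset_le _ _
    _ ≤ ∑ w ∈ words S N, ν (PiNat.cylinder w N) := Finset.sum_le_sum fun w _ => h w
    _ = ν (⋃ w ∈ words S N, PiNat.cylinder w N) :=
        (measure_biUnion_finset hd fun w _ => (isClopen_piNatCylinder w N).2.measurableSet).symm
    _ = ν S := by rw [← hU]

/-- An inequality between measures can be checked on cylinders: open sets are increasing unions
of finite disjoint unions of cylinders, and finite measures are outer regular. -/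
theorem measure_le_of_forall_piNatCylinder {A : Type*} [Finite A] [Nonempty A]
    [TopologicalSpace A] [DiscreteTopology A] [MeasurableSpace A] [BorelSpace A]
    {μ ν : Measure (ℕ → A)} [IsFiniteMeasure ν]
    (h : ∀ n w, μ (PiNat.cylinder w (n + 1)) ≤ ν (PiNat.cylinder w (n + 1))) : μ ≤ ν := by
  have hopen : ∀ U : Set (ℕ → A), IsOpen U → μ U ≤ ν U := by
    intro U hU
    have hmono : Monotone fun n => {a | PiNat.cylinder a (n + 1) ⊆ U} := fun m n hmn a ha =>
      (PiNat.cylinder_anti a (Nat.succ_le_succ hmn)).trans ha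
    have hUn : U = ⋃ n, {a | PiNat.cylinder a (n + 1) ⊆ U} := by
      ext a
      simp only [Set.mem_iUnion]
      constructor
      · intro ha
        obtain ⟨N, hN⟩ := exists_cylinder_subset hU ha
        exact ⟨N, (PiNat.cylinder_anti a N.le_succ).trans hN⟩
      · rintro ⟨n, hn⟩
        exact hn (PiNat.self_mem_cylinder a _)
    rw [hUn, hmono.measure_iUnion, hmono.measure_iUnion]
    refine iSup_mono fun n => measure_le_of_piNatCylinder_subset (h n) fun a ha b hb => ?_
    exact (PiNat.mem_cylinder_iff_eq.1 hb).trans_subset ha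
  refine Measure.le_iff.2 fun s _ => ?_
  rw [s.measure_eq_iInf_isOpen ν]
  exact le_iInf fun U => le_iInf fun hsU => le_iInf fun hU =>
    (measure_mono hsU).trans (hopen U hU)

/-- The Gibbs bounds with constant `exp G`, on the cylinders of `A^ℕ` instead of those of `Y`. -/
def HasGibbsBounds {A : Type*} [MeasurableSpace A] (φ : (ℕ → A) → ℝ) (Y : Set (ℕ → A))
    (μ : ProbabilityMeasure (ℕ → A)) (G P : ℝ) : Prop :=
  ∀ n : ℕ, ∀ a ∈ Y,
    Real.exp (birkhoffSum shift φ (n + 1) a - (n + 1) * P - G) ≤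
        (μ : Measure (ℕ → A)).real (PiNat.cylinder a (n + 1)) ∧
      (μ : Measure (ℕ → A)).real (PiNat.cylinder a (n + 1)) ≤
        Real.exp (birkhoffSum shift φ (n + 1) a - (n + 1) * P + G)

theorem word_eq_word_iff {A : Type*} {a b : ℕ → A} {i j n : ℕ} :
    word a i (i + n) = word b j (j + n) ↔
      shift^[i] a ∈ PiNat.cylinder (shift^[j] b) (n + 1) := by
  have h : ∀ (a : ℕ → A) (i : ℕ), word a i (i + n) = (List.range (n + 1)).map (shift^[i] a) := by
    intro a i
    have h0 := List.Ico.map_add 0 (n + 1) i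
    rw [zero_add, List.Ico.zero_bot] at h0
    rw [word, show i + n + 1 = n + 1 + i by omega, ← h0, List.map_map]
    refine List.map_congr_left fun k _ => ?_
    rw [iterate_shift_apply]
    simp
  rw [h, h, List.map_inj_left]
  simp only [List.mem_range]
  rfl

theorem word_zero_eq_iff {A : Type*} {a b : ℕ → A} {n : ℕ} :
    word a 0 n = word b 0 n ↔ a ∈ PiNat.cylinder b (n + 1) := by
  simpa using word_eq_word_iff (a := a) (b := b) (i := 0) (j := 0) (n := n)

theorem gibbsInequality_exp_iff {A : Type*} [Finite A] [TopologicalSpace A] [DiscreteTopology A]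
    [MeasurableSpace A] [BorelSpace A] {φ : (ℕ → A) → ℝ} {Y : Set (ℕ → A)} (hY : IsClosed Y)
    {μ : ProbabilityMeasure (ℕ → A)} (hμ : (μ : Measure (ℕ → A)) Y = 1) {G P : ℝ} :
    GibbsInequality φ Y μ (Real.exp G) P ↔ HasGibbsBounds φ Y μ G P := by
  refine forall_congr' fun n => forall_congr' fun a => forall_congr' fun _ => ?_
  have e : (μ : Measure (ℕ → A)).real (cylinder Y a n) =
      (μ : Measure (ℕ → A)).real (PiNat.cylinder a (n + 1)) := by
    have : cylinder Y a n = PiNat.cylinder a (n + 1) ∩ Y := by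
      ext b
      simp only [cylinder, Set.mem_ofPred_eq, word_zero_eq_iff, Set.mem_inter_iff]
      exact and_comm
    rw [this]
    refine measureReal_congr ?_
    have : ∀ᵐ b ∂(μ : Measure (ℕ → A)), b ∈ Y :=
      (prob_compl_eq_zero_iff hY.measurableSet).2 hμ
    filter_upwards [this] with b hb
    exact propext ⟨fun h => h.1, fun h => ⟨h, hb⟩⟩
  rw [e, le_div_iff₀ (Real.exp_pos _), div_le_iff₀ (Real.exp_pos _), ← Real.exp_neg,
    ← Real.exp_add, ← Real.exp_add]
  rw [show -G + (ergodicSum φ n a - ((n : ℝ) + 1) * P) =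
    birkhoffSum shift φ (n + 1) a - (n + 1) * P - G by rw [ergodicSum, birkhoffSum]; ring,
    show G + (ergodicSum φ n a - ((n : ℝ) + 1) * P) =
    birkhoffSum shift φ (n + 1) a - (n + 1) * P + G by rw [ergodicSum, birkhoffSum]; ring]

/-! ### Ergodicity and uniqueness of Gibbs measures -/

theorem measure_piNatCylinder_eq_zero {A : Type*} [Finite A] [TopologicalSpace A]
    [DiscreteTopology A] [MeasurableSpace A] [BorelSpace A] {Y : Set (ℕ → A)} (hY : IsClosed Y)
    {μ : ProbabilityMeasure (ℕ → A)} (hμ : (μ : Measure (ℕ → A)) Y = 1) {w : ℕ → A} {N : ℕ}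
    (h : ∀ y ∈ Y, y ∉ PiNat.cylinder w N) : (μ : Measure (ℕ → A)) (PiNat.cylinder w N) = 0 :=
  measure_mono_null (fun y hy hyY => h y hyY hy : PiNat.cylinder w N ⊆ Yᶜ)
    ((prob_compl_eq_zero_iff hY.measurableSet).2 hμ)

/-- A Gibbs measure gives the concatenation of two words across a gap of `l` letters at least a
fixed proportion of the product of their measures. -/
theorem HasGluing.exists_mul_measure_le {A : Type*} [Finite A] [TopologicalSpace A]
    [DiscreteTopology A] [MeasurableSpace A] [BorelSpace A] {φ : (ℕ → A) → ℝ} {B D : ℝ}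
    (hφ : HasBoundedDistortion φ B D) {Y : Set (ℕ → A)} {l : ℕ} (hY : HasGluing Y l)
    (hYc : IsClosed Y) {μ : ProbabilityMeasure (ℕ → A)} (hμ : (μ : Measure (ℕ → A)) Y = 1)
    {G P : ℝ} (hG : HasGibbsBounds φ Y μ G P) : ∃ c : ENNReal, c ≠ 0 ∧ ∀ (m n : ℕ) (u v : ℕ → A),
      c * (μ : Measure (ℕ → A)) (PiNat.cylinder u (m + 1)) *
          (μ : Measure (ℕ → A)) (PiNat.cylinder v (n + 1)) ≤
        (μ : Measure (ℕ → A))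
          (shift^[m + 1 + l] ⁻¹' PiNat.cylinder v (n + 1) ∩ PiNat.cylinder u (m + 1)) := by
  refine ⟨ENNReal.ofReal (Real.exp (-(3 * G + 2 * D + l * B + l * P))),
    (ENNReal.ofReal_pos.2 (Real.exp_pos _)).ne', fun m n u v => ?_⟩
  by_cases hu : ∃ a ∈ Y, a ∈ PiNat.cylinder u (m + 1)
  swap
  · rw [measure_piNatCylinder_eq_zero hYc hμ (by simpa using hu)]
    simp
  by_cases hv : ∃ b ∈ Y, b ∈ PiNat.cylinder v (n + 1)
  swap
  · rw [measure_piNatCylinder_eq_zero hYc hμ (w := v) (by simpa using hv)]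
    simp
  obtain ⟨a, ha, hau⟩ := hu
  obtain ⟨b, hb, hbv⟩ := hv
  rw [← PiNat.mem_cylinder_iff_eq.1 hau, ← PiNat.mem_cylinder_iff_eq.1 hbv]
  obtain ⟨c, hc, h1, h2⟩ := hY.glue (m + 1) (n + 1) (by omega) (by omega) a ha b hb
  have hsub : PiNat.cylinder c (m + 1 + l + n + 1) ⊆
      shift^[m + 1 + l] ⁻¹' PiNat.cylinder b (n + 1) ∩ PiNat.cylinder a (m + 1) := by
    refine fun x hx => ⟨fun i hi => ?_, fun i hi => (hx i (by omega)).trans (h1 i hi)⟩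
    rw [← h2 i hi, iterate_shift_apply, iterate_shift_apply]
    exact hx _ (by omega)
  refine le_trans ?_ (measure_mono hsub)
  rw [← ofReal_measureReal, ← ofReal_measureReal, ← ofReal_measureReal,
    ← ENNReal.ofReal_mul (Real.exp_pos _).le, ← ENNReal.ofReal_mul (by positivity)]
  refine ENNReal.ofReal_le_ofReal ?_
  have ea := (hG m a ha).2
  have eb := (hG n b hb).2
  have ec := (hG (m + 1 + l + n) c hc).1
  refine le_trans ?_ ec
  refine (mul_le_mul (mul_le_mul_of_nonneg_left ea (Real.exp_pos _).le) eb measureReal_nonneg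
    (by positivity)).trans ?_
  rw [← Real.exp_add, ← Real.exp_add, Real.exp_le_exp, add_assoc (m + 1 + l) n 1,
    birkhoffSum_add shift φ (m + 1 + l), birkhoffSum_add shift φ (m + 1) l]
  have := hφ.le_birkhoffSum h1
  have := hφ.le_birkhoffSum h2
  have := (abs_le.1 (hφ.abs_birkhoffSum_le l (shift^[m + 1] c))).1
  push_cast
  linarith

theorem HasGluing.ergodic {A : Type*} [Finite A] [Nonempty A] [TopologicalSpace A]
    [DiscreteTopology A] [MeasurableSpace A] [BorelSpace A] {φ : (ℕ → A) → ℝ} {B D : ℝ}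
    (hφ : HasBoundedDistortion φ B D) {Y : Set (ℕ → A)} {l : ℕ} (hY : HasGluing Y l)
    (hYc : IsClosed Y) {μ : ProbabilityMeasure (ℕ → A)} (hμ : IsInvariantOn Y μ)
    {G P : ℝ} (hG : HasGibbsBounds φ Y μ G P) : Ergodic shift (μ : Measure (ℕ → A)) := by
  refine ⟨hμ.measurePreserving, ⟨fun s hs hinv => ?_⟩⟩
  obtain ⟨c, hc, hmix⟩ := hY.exists_mul_measure_le hφ hYc hμ.full hG
  set m : Measure (ℕ → A) := (μ : Measure (ℕ → A))
  have hinv' : ∀ k : ℕ, shift^[k] ⁻¹' s = s := fun k => by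
    rw [Set.preimage_iterate_eq]
    exact Function.iterate_fixed hinv k
  -- The mixing inequality extends from cylinders to all measurable sets, first in the second
  -- argument, where it is applied to the invariant set `s`, and then in the first argument.
  have h1 : ∀ (n : ℕ) (u : ℕ → A), c * m (PiNat.cylinder u (n + 1)) * m s ≤
      m (s ∩ PiNat.cylinder u (n + 1)) := by
    intro n u
    have hmeas : Measurable (shift^[n + 1 + l] : (ℕ → A) → ℕ → A) :=
      (continuous_shift.iterate _).measurable
    have hle : (c * m (PiNat.cylinder u (n + 1))) • m ≤
        (m.restrict (PiNat.cylinder u (n + 1))).map (shift^[n + 1 + l]) := by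
      refine measure_le_of_forall_piNatCylinder fun k v => ?_
      have hv := (isClopen_piNatCylinder v (k + 1)).2.measurableSet
      rw [Measure.map_apply hmeas hv, Measure.restrict_apply (hmeas hv), Measure.smul_apply]
      exact hmix n k u v
    have := hle s
    rwa [Measure.map_apply hmeas hs, Measure.restrict_apply (hmeas hs), Measure.smul_apply,
      hinv'] at this
  have h2 : (c * m s) • m ≤ m.restrict s := by
    refine measure_le_of_forall_piNatCylinder fun n u => ?_
    rw [Measure.restrict_apply (isClopen_piNatCylinder u _).2.measurableSet, Set.inter_comm,
      Measure.smul_apply, smul_eq_mul, mul_right_comm]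
    exact h1 n u
  have h3 := h2 sᶜ
  rw [Measure.restrict_apply hs.compl, Set.compl_inter_self, measure_empty, Measure.smul_apply,
    smul_eq_mul, nonpos_iff_eq_zero, mul_eq_zero, mul_eq_zero] at h3
  refine eventuallyConst_set.2 ?_
  rcases h3 with (h | h) | h
  · exact absurd h hc
  · exact Or.inr (measure_eq_zero_iff_ae_notMem.1 h)
  · exact Or.inl h

theorem HasGibbsBounds.measure_le {A : Type*} [Finite A] [TopologicalSpace A]
    [DiscreteTopology A] [MeasurableSpace A] [BorelSpace A] {φ : (ℕ → A) → ℝ}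
    {Y : Set (ℕ → A)} (hYc : IsClosed Y) {μ ν : ProbabilityMeasure (ℕ → A)} {G G' P P' : ℝ}
    (hν : (ν : Measure (ℕ → A)) Y = 1) (hG : HasGibbsBounds φ Y μ G P)
    (hG' : HasGibbsBounds φ Y ν G' P') (n : ℕ) (w : ℕ → A) :
    (ν : Measure (ℕ → A)) (PiNat.cylinder w (n + 1)) ≤
      (ENNReal.ofReal (Real.exp (G + G' + (n + 1) * (P - P'))) • (μ : Measure (ℕ → A)))
        (PiNat.cylinder w (n + 1)) := by
  by_cases hw : ∃ a ∈ Y, a ∈ PiNat.cylinder w (n + 1)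
  swap
  · rw [measure_piNatCylinder_eq_zero hYc hν (by simpa using hw)]
    exact zero_le
  obtain ⟨a, ha, haw⟩ := hw
  rw [← PiNat.mem_cylinder_iff_eq.1 haw, Measure.smul_apply, smul_eq_mul, ← ofReal_measureReal,
    ← ofReal_measureReal, ← ENNReal.ofReal_mul (Real.exp_pos _).le]
  refine ENNReal.ofReal_le_ofReal ?_
  refine (hG' n a ha).2.trans (le_trans ?_
    (mul_le_mul_of_nonneg_left (hG n a ha).1 (Real.exp_pos _).le))
  rw [← Real.exp_add, Real.exp_le_exp]
  linarith

theorem HasGibbsBounds.pressure_le {A : Type*} [Finite A] [Nonempty A] [TopologicalSpace A]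
    [DiscreteTopology A] [MeasurableSpace A] [BorelSpace A] {φ : (ℕ → A) → ℝ}
    {Y : Set (ℕ → A)} (hYc : IsClosed Y) {μ ν : ProbabilityMeasure (ℕ → A)} {G G' P P' : ℝ}
    (hν : (ν : Measure (ℕ → A)) Y = 1) (hG : HasGibbsBounds φ Y μ G P)
    (hG' : HasGibbsBounds φ Y ν G' P') : P' ≤ P := by
  by_contra! hlt
  obtain ⟨n, hn⟩ := exists_nat_gt ((G + G') / (P' - P))
  rw [div_lt_iff₀ (by linarith)] at hn
  have h := measure_le_of_piNatCylinder_subset (hG.measure_le hYc hν hG' n) (S := Set.univ)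
    fun _ _ => Set.subset_univ _
  rw [Measure.smul_apply, measure_univ, measure_univ, smul_eq_mul, mul_one,
    ENNReal.one_le_ofReal, Real.one_le_exp_iff] at h
  linarith

/-- Two Gibbs measures have the same pressure, hence are dominated by multiples of each other,
and they agree because they are ergodic. -/
theorem HasGluing.gibbs_unique {A : Type*} [Finite A] [Nonempty A] [TopologicalSpace A]
    [DiscreteTopology A] [MeasurableSpace A] [BorelSpace A] {φ : (ℕ → A) → ℝ} {B D : ℝ}
    (hφ : HasBoundedDistortion φ B D) {Y : Set (ℕ → A)} {l : ℕ} (hY : HasGluing Y l)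
    (hYc : IsClosed Y) {μ ν : ProbabilityMeasure (ℕ → A)} (hμ : IsInvariantOn Y μ)
    (hν : IsInvariantOn Y ν) {G G' P P' : ℝ} (hG : HasGibbsBounds φ Y μ G P)
    (hG' : HasGibbsBounds φ Y ν G' P') : ν = μ := by
  obtain rfl : P = P' :=
    le_antisymm (hG'.pressure_le hYc hμ.full hG) (hG.pressure_le hYc hν.full hG')
  have hle : (ν : Measure (ℕ → A)) ≤
      ENNReal.ofReal (Real.exp (G + G')) • (μ : Measure (ℕ → A)) := by
    have := Measure.smul_finite (μ : Measure (ℕ → A))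
      (c := ENNReal.ofReal (Real.exp (G + G'))) ENNReal.ofReal_ne_top
    refine measure_le_of_forall_piNatCylinder fun n w => ?_
    simpa using hG.measure_le hYc hν.full hG' n w
  have hac := (Measure.absolutelyContinuous_of_le hle).trans
    (Measure.smul_absolutelyContinuous)
  have key : (ν : Measure (ℕ → A)) = μ :=
    (hY.ergodic hφ hYc hμ hG).eq_of_absolutelyContinuous hν.measurePreserving hac
  exact Subtype.ext key

/-! ### Existence of Gibbs measures -/

/-- Cylinders are clopen, so invariance, the support and Gibbs bounds pass to weak limits. -/
theorem gibbs_of_mapClusterPt {A : Type*} [Finite A] [TopologicalSpace A] [DiscreteTopology A]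
    [MeasurableSpace A] [BorelSpace A] {φ : (ℕ → A) → ℝ} {Y : Set (ℕ → A)} (hY : IsClosed Y)
    {μ : ℕ → ProbabilityMeasure (ℕ → A)} {ν : ProbabilityMeasure (ℕ → A)}
    (hν : MapClusterPt ν atTop μ)
    (hinv : ∀ᶠ k in atTop,
      MeasurePreserving shift (μ k : Measure (ℕ → A)) (μ k : Measure (ℕ → A)))
    (hnull : ∀ (w : ℕ → A) (N : ℕ), Disjoint (PiNat.cylinder w N) Y →
      ∀ᶠ k in atTop, (μ k : Measure (ℕ → A)) (PiNat.cylinder w N) = 0)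
    {G P : ℝ} (hbd : ∀ n : ℕ, ∀ a ∈ Y, ∀ᶠ k in atTop,
      Real.exp (birkhoffSum shift φ (n + 1) a - (n + 1) * P - G) ≤
          (μ k : Measure (ℕ → A)).real (PiNat.cylinder a (n + 1)) ∧
        (μ k : Measure (ℕ → A)).real (PiNat.cylinder a (n + 1)) ≤
          Real.exp (birkhoffSum shift φ (n + 1) a - (n + 1) * P + G)) :
    IsInvariantOn Y ν ∧ HasGibbsBounds φ Y ν G P := by
  have hcont : ∀ (w : ℕ → A) (N : ℕ), Continuous fun μ : ProbabilityMeasure (ℕ → A) =>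
      (μ : Measure (ℕ → A)).real (PiNat.cylinder w N) := by
    intro w N
    refine NNReal.continuous_coe.comp (continuous_iff_continuousAt.2 fun μ => ?_)
    exact ProbabilityMeasure.tendsto_measure_of_isClopen_of_tendsto tendsto_id
      (isClopen_piNatCylinder w N)
  have hmap := ProbabilityMeasure.continuous_map (continuous_shift (A := A))
  refine ⟨⟨⟨continuous_shift.measurable, ?_⟩, ?_⟩, fun n a ha => ?_⟩
  · have hfix : ν.map continuous_shift.measurable.aemeasurable = ν := by
      refine (isClosed_eq hmap continuous_id).mem_of_mapClusterPt hν ?_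
      filter_upwards [hinv] with k hk
      exact Subtype.ext hk.map_eq
    exact congrArg Subtype.val hfix
  · rw [← prob_compl_eq_zero_iff hY.measurableSet]
    refine measure_null_of_locally_null _ fun a ha => ?_
    obtain ⟨N, hN⟩ := exists_cylinder_subset hY.isOpen_compl ha
    refine ⟨_, mem_nhdsWithin_of_mem_nhds ((PiNat.isOpen_cylinder _ a N).mem_nhds
      (PiNat.self_mem_cylinder a N)), ?_⟩
    have : (ν : Measure (ℕ → A)).real (PiNat.cylinder a N) = 0 := by
      refine (isClosed_eq (hcont a N) continuous_const).mem_of_mapClusterPt hν ?_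
      filter_upwards [hnull a N (Set.disjoint_left.2 fun b hb => hN hb)] with k hk
      exact (measureReal_eq_zero_iff).2 hk
    exact (measureReal_eq_zero_iff).1 this
  · exact ((isClosed_le continuous_const (hcont a (n + 1))).inter
      (isClosed_le (hcont a (n + 1)) continuous_const)).mem_of_mapClusterPt hν (hbd n a ha)

theorem birkhoffSum_shift_of_periodic {A : Type*} (φ : (ℕ → A) → ℝ) {k : ℕ} {c : ℕ → A}
    (hc : shift^[k] c = c) : birkhoffSum shift φ k (shift c) = birkhoffSum shift φ k c := by
  have h := birkhoffSum_apply_sub_birkhoffSum shift φ k c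
  rwa [hc, sub_self, sub_eq_zero] at h

/-- The invariant probability measure that gives to every sequence of period `k + 1` in `Y` a mass
proportional to `exp (S_k φ)`. -/
theorem exists_measure_of_periodicSeqs {A : Type*} [Finite A] [TopologicalSpace A]
    [DiscreteTopology A] [MeasurableSpace A] [BorelSpace A] (φ : (ℕ → A) → ℝ) {Y : Set (ℕ → A)}
    (hY : Set.MapsTo shift Y Y) {k : ℕ} (hk : (periodicSeqs Y (k + 1)).Nonempty) :
    ∃ μ : ProbabilityMeasure (ℕ → A),
      MeasurePreserving shift (μ : Measure (ℕ → A)) (μ : Measure (ℕ → A)) ∧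
      (∀ s, MeasurableSet s → Disjoint s Y → (μ : Measure (ℕ → A)) s = 0) ∧
      ∀ (a : ℕ → A) (M : ℕ), (μ : Measure (ℕ → A)).real (PiNat.cylinder a M) =
        periodicSum φ Y k a M / periodicSum φ Y k a 0 := by
  classical
  set S := (finite_periodicSeqs Y k).toFinset with hS
  have hmemS : ∀ c, c ∈ S ↔ c ∈ Y ∧ shift^[k + 1] c = c := fun c => Set.Finite.mem_toFinset _
  set T : ℝ := ∑ c ∈ S, Real.exp (birkhoffSum shift φ (k + 1) c) with hT
  have hTpos : 0 < T :=
    Finset.sum_pos (fun _ _ => Real.exp_pos _) ((Set.Finite.toFinset_nonempty _).2 hk)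
  set m : Measure (ℕ → A) := ∑ c ∈ S,
    ENNReal.ofReal (Real.exp (birkhoffSum shift φ (k + 1) c) / T) • Measure.dirac c with hm
  have hmapply : ∀ s, MeasurableSet s → m s = ENNReal.ofReal
      ((∑ c ∈ S with c ∈ s, Real.exp (birkhoffSum shift φ (k + 1) c)) / T) := by
    intro s hs
    rw [hm, Measure.finsetSum_apply, Finset.sum_div, Finset.sum_filter,
      ENNReal.ofReal_sum_of_nonneg fun _ _ => by positivity]
    refine Finset.sum_congr rfl fun c _ => ?_
    rw [Measure.smul_apply, Measure.dirac_apply' _ hs]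
    by_cases hc : c ∈ s <;> simp [hc]
  have hprob : IsProbabilityMeasure m := ⟨by
    rw [hmapply _ MeasurableSet.univ]
    simp [← hT, div_self hTpos.ne']⟩
  have hmeas : Measurable (shift : (ℕ → A) → ℕ → A) := continuous_shift.measurable
  refine ⟨⟨m, hprob⟩, ⟨hmeas, Measure.ext fun s hs => ?_⟩, fun s hs hd => ?_, fun a M => ?_⟩
  · change m.map shift s = m s
    rw [Measure.map_apply hmeas hs, hmapply _ (hmeas hs), hmapply _ hs]
    congr 2
    refine Finset.sum_nbij' shift shift^[k] ?_ ?_ ?_ ?_ ?_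
    · intro c hc
      rw [Finset.mem_filter, hmemS] at hc ⊢
      refine ⟨⟨hY hc.1.1, ?_⟩, hc.2⟩
      rw [← Function.iterate_succ_apply, Function.iterate_succ_apply' shift, hc.1.2]
    · intro c hc
      rw [Finset.mem_filter, hmemS] at hc ⊢
      refine ⟨⟨hY.iterate k hc.1.1, ?_⟩, ?_⟩
      · rw [← Function.iterate_add_apply, add_comm, Function.iterate_add_apply, hc.1.2]
      · rw [Set.mem_preimage, ← Function.iterate_succ_apply' shift, hc.1.2]
        exact hc.2
    · intro c hc
      rw [Finset.mem_filter, hmemS] at hc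
      rw [← Function.iterate_succ_apply, hc.1.2]
    · intro c hc
      rw [Finset.mem_filter, hmemS] at hc
      rw [← Function.iterate_succ_apply' shift, hc.1.2]
    · intro c hc
      rw [Finset.mem_filter, hmemS] at hc
      rw [birkhoffSum_shift_of_periodic φ hc.1.2]
  · change m s = 0
    rw [hmapply s hs, Finset.filter_false_of_mem]
    · simp
    · exact fun c hc hcs => Set.disjoint_left.1 hd hcs ((hmemS c).1 hc).1
  · change (m (PiNat.cylinder a M)).toReal = _
    rw [hmapply _ (isClopen_piNatCylinder a M).2.measurableSet, ENNReal.toReal_ofReal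
      (div_nonneg (Finset.sum_nonneg fun _ _ => (Real.exp_pos _).le) hTpos.le), periodicSum_zero]
    rfl

theorem HasGluing.exists_gibbs {A : Type*} [Finite A] [Nonempty A] [TopologicalSpace A]
    [DiscreteTopology A] [MeasurableSpace A] [BorelSpace A] {φ : (ℕ → A) → ℝ} {B D : ℝ}
    (hφ : HasBoundedDistortion φ B D) {Y : Set (ℕ → A)} {l : ℕ} (hY : HasGluing Y l)
    (hYc : IsClosed Y) {P : ℝ}
    (hP : ∀ N : ℕ, |Real.log (partitionFunction φ Y N) - N * P| ≤ gluingConst A l B D) :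
    ∃ μ : ProbabilityMeasure (ℕ → A),
      IsInvariantOn Y μ ∧ HasGibbsBounds φ Y μ (2 * periodicConst A l B D) P := by
  have hex : ∀ k : ℕ, ∃ μ : ProbabilityMeasure (ℕ → A), (periodicSeqs Y (k + 1)).Nonempty →
      MeasurePreserving shift (μ : Measure (ℕ → A)) (μ : Measure (ℕ → A)) ∧
      (∀ s, MeasurableSet s → Disjoint s Y → (μ : Measure (ℕ → A)) s = 0) ∧
      ∀ (a : ℕ → A) (M : ℕ), (μ : Measure (ℕ → A)).real (PiNat.cylinder a M) =
        periodicSum φ Y k a M / periodicSum φ Y k a 0 := by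
    intro k
    by_cases hk : (periodicSeqs Y (k + 1)).Nonempty
    · obtain ⟨μ, hμ⟩ := exists_measure_of_periodicSeqs φ hY.mapsTo hk
      exact ⟨μ, fun _ => hμ⟩
    · exact ⟨⟨Measure.dirac fun _ => Classical.arbitrary A, inferInstance⟩, fun h => absurd h hk⟩
  choose μ hμ using hex
  have hne : ∀ᶠ k in atTop, (periodicSeqs Y (k + 1)).Nonempty := by
    obtain ⟨a, ha⟩ := hY.nonempty
    filter_upwards [hY.eventually_periodicSum_bounds hφ hP 0 ha] with k hk
    by_contra h
    have := (Real.exp_pos _).trans_le hk.1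
    simp [periodicSum, Set.not_nonempty_iff_eq_empty.1 h] at this
  obtain ⟨ν, hν⟩ := exists_clusterPt_of_compactSpace (map μ atTop)
  refine ⟨ν, gibbs_of_mapClusterPt hYc hν ?_ ?_ ?_⟩
  · filter_upwards [hne] with k hk using (hμ k hk).1
  · intro w N hd
    filter_upwards [hne] with k hk
    exact (hμ k hk).2.1 _ (isClopen_piNatCylinder w N).2.measurableSet hd
  · intro n a ha
    filter_upwards [hne, hY.eventually_periodicSum_bounds hφ hP 0 ha,
      hY.eventually_periodicSum_bounds hφ hP (n + 1) ha] with k hk h0 hn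
    have hpos := (Real.exp_pos _).trans_le h0.1
    rw [birkhoffSum_zero, Nat.cast_zero] at h0
    push_cast at hn
    rw [(hμ k hk).2.2, le_div_iff₀ hpos, div_le_iff₀ hpos]
    constructor
    · refine (mul_le_mul_of_nonneg_left h0.2 (Real.exp_pos _).le).trans (le_trans ?_ hn.1)
      rw [← Real.exp_add, Real.exp_le_exp]
      linarith
    · refine hn.2.trans (le_trans ?_ (mul_le_mul_of_nonneg_left h0.1 (Real.exp_pos _).le))
      rw [← Real.exp_add, Real.exp_le_exp]
      linarith

/-! ### Specification of the finite type approximations -/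

theorem IsSpecified.exists_mem {A : Type*} {X : Set (ℕ → A)} {l : ℕ} (hX : IsSpecified X l)
    {M N k k' : ℕ} (hM : 1 ≤ M) (hN : 1 ≤ N) (hk : l ≤ k) (hk' : l ≤ k') {a b : ℕ → A}
    (ha : a ∈ X) (hb : b ∈ X) : ∃ c ∈ X, shift^[M + k + N + k'] c = c ∧
      c ∈ PiNat.cylinder a M ∧ shift^[M + k] c ∈ PiNat.cylinder b N := by
  obtain ⟨m, rfl⟩ : ∃ m, M = m + 1 := ⟨M - 1, by omega⟩
  obtain ⟨n, rfl⟩ : ∃ n, N = n + 1 := ⟨N - 1, by omega⟩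
  obtain ⟨c, ⟨hc, hper⟩, h1, h2⟩ := hX m n _ ⟨a, ha, rfl⟩ _ ⟨b, hb, rfl⟩ k k' hk hk'
  rw [word_zero_eq_iff] at h1 h2
  rw [show m + n + k + k' + 2 = m + 1 + k + (n + 1) + k' by omega] at hper
  rw [show m + k + 1 = m + 1 + k by omega] at h2
  exact ⟨c, hc, hper, h1, h2⟩

theorem IsSpecified.hasGluing {A : Type*} [TopologicalSpace A] {X : Set (ℕ → A)} {l : ℕ}
    (hX : IsSpecified X l) (hsub : IsSubshift X) (hne : X.Nonempty) : HasGluing X l where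
  nonempty := hne
  mapsTo := hsub.mapsTo
  glue M N hM hN a ha b hb := by
    obtain ⟨c, hc, -, h⟩ := hX.exists_mem hM hN le_rfl le_rfl ha hb
    exact ⟨c, hc, h⟩
  close := ⟨1, fun M N hM hN a ha b hb => hX.exists_mem hM hN le_rfl le_rfl ha hb⟩

theorem mem_ftApprox {A : Type*} {X : Set (ℕ → A)} {m : ℕ} {a : ℕ → A} :
    a ∈ ftApprox X m ↔ ∀ j, ∃ x ∈ X, shift^[j] a ∈ PiNat.cylinder x (m + 1) := by
  refine forall_congr' fun j => exists_congr fun x => and_congr_right fun _ => ?_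
  have h := word_eq_word_iff (a := a) (b := x) (i := j) (j := 0) (n := m)
  rw [zero_add, Function.iterate_zero_apply] at h
  rw [eq_comm, h]

theorem exists_mem_cylinder_of_mem_ftApprox {A : Type*} {X : Set (ℕ → A)} {m N : ℕ}
    {a : ℕ → A} (ha : a ∈ ftApprox X m) (hN : N ≤ m + 1) : ∃ x ∈ X, a ∈ PiNat.cylinder x N := by
  obtain ⟨x, hx, h⟩ := mem_ftApprox.1 ha 0
  exact ⟨x, hx, PiNat.cylinder_anti x hN h⟩

theorem mapsTo_shift_ftApprox {A : Type*} (X : Set (ℕ → A)) (m : ℕ) :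
    Set.MapsTo shift (ftApprox X m) (ftApprox X m) := fun _ ha =>
  mem_ftApprox.2 fun j => by simpa using mem_ftApprox.1 ha (j + 1)

theorem subset_ftApprox {A : Type*} {X : Set (ℕ → A)} (hX : Set.MapsTo shift X X) (m : ℕ) :
    X ⊆ ftApprox X m := fun _ ha =>
  mem_ftApprox.2 fun j => ⟨_, hX.iterate j ha, PiNat.self_mem_cylinder _ _⟩

theorem isClosed_ftApprox {A : Type*} [TopologicalSpace A] [DiscreteTopology A]
    (X : Set (ℕ → A)) (m : ℕ) : IsClosed (ftApprox X m) := by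
  have hS : IsClosed {b : ℕ → A | ∃ x ∈ X, b ∈ PiNat.cylinder x (m + 1)} := by
    refine ⟨isOpen_iff_mem_nhds.2 fun b hb => ?_⟩
    filter_upwards [(PiNat.isOpen_cylinder _ b (m + 1)).mem_nhds (PiNat.self_mem_cylinder b _)]
      with c hc
    rintro ⟨x, hx, hcx⟩
    exact hb ⟨x, hx, fun i hi => (hc i hi).symm.trans (hcx i hi)⟩
  have : ftApprox X m =
      ⋂ j, shift^[j] ⁻¹' {b : ℕ → A | ∃ x ∈ X, b ∈ PiNat.cylinder x (m + 1)} := by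
    ext a
    simp [mem_ftApprox]
  rw [this]
  exact isClosed_iInter fun j => hS.preimage (continuous_shift.iterate j)

theorem partitionFunction_ftApprox {A : Type*} [Nonempty A] [Finite A] (φ : (ℕ → A) → ℝ)
    {X : Set (ℕ → A)} (hX : Set.MapsTo shift X X) {m N : ℕ} (hN : N ≤ m + 1) :
    partitionFunction φ (ftApprox X m) N = partitionFunction φ X N := by
  have : words (ftApprox X m) N = words X N := by
    ext w
    rw [mem_words, mem_words]
    constructor
    · rintro ⟨a, ha, rfl⟩
      obtain ⟨x, hx, hax⟩ := exists_mem_cylinder_of_mem_ftApprox ha hN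
      exact ⟨x, hx, (truncate_eq_of_mem_cylinder hax).symm⟩
    · rintro ⟨x, hx, rfl⟩
      exact ⟨x, subset_ftApprox hX m hx, rfl⟩
  rw [partitionFunction, partitionFunction, this]

/-- The first `s` letters of `a`, followed by `b`. -/
def splice {A : Type*} (s : ℕ) (a b : ℕ → A) : ℕ → A := fun i => if i < s then a i else b (i - s)

theorem iterate_shift_splice {A : Type*} (s : ℕ) (a b : ℕ → A) :
    shift^[s] (splice s a b) = b := by
  funext i
  simp [iterate_shift_apply, splice]

/-- Sequences in `X_m` can be concatenated if they overlap in `m` letters. -/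
theorem splice_mem_ftApprox {A : Type*} {X : Set (ℕ → A)} {m s : ℕ} {a b : ℕ → A}
    (ha : a ∈ ftApprox X m) (hb : b ∈ ftApprox X m) (h : ∀ i < m, a (s + i) = b i) :
    splice s a b ∈ ftApprox X m := by
  refine mem_ftApprox.2 fun j => ?_
  rcases lt_or_ge j s with hj | hj
  · obtain ⟨x, hx, hax⟩ := mem_ftApprox.1 ha j
    refine ⟨x, hx, fun i hi => ?_⟩
    rw [← hax i hi, iterate_shift_apply, iterate_shift_apply, splice]
    split_ifs with hji
    · rfl
    · rw [← h _ (by omega), Nat.add_sub_cancel' (by omega)]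
  · obtain ⟨j, rfl⟩ : ∃ i, j = i + s := ⟨j - s, by omega⟩
    rw [Function.iterate_add_apply, iterate_shift_splice]
    exact mem_ftApprox.1 hb j

theorem IsSpecified.exists_concat_ftApprox {A : Type*} [TopologicalSpace A] {X : Set (ℕ → A)}
    {l : ℕ} (hX : IsSpecified X l) (hsub : IsSubshift X) {m : ℕ} (hm : 1 ≤ m) {M : ℕ}
    (hM : 1 ≤ M) {a b : ℕ → A} (ha : a ∈ ftApprox X m) (hb : b ∈ ftApprox X m) :
    ∃ c ∈ ftApprox X m, c ∈ PiNat.cylinder a M ∧ shift^[M + l] c = b := by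
  have short : ∀ M, 1 ≤ M → M ≤ m → ∀ a ∈ ftApprox X m,
      ∃ c ∈ ftApprox X m, c ∈ PiNat.cylinder a M ∧ shift^[M + l] c = b := by
    intro M hM hMm a ha
    obtain ⟨x, hx, hax⟩ := exists_mem_cylinder_of_mem_ftApprox ha (show M ≤ m + 1 by omega)
    obtain ⟨y, hy, hby⟩ := exists_mem_cylinder_of_mem_ftApprox hb m.le_succ
    obtain ⟨c, hc, -, h1, h2⟩ := hX.exists_mem hM hm le_rfl le_rfl hx hy
    refine ⟨splice (M + l) c b, splice_mem_ftApprox (subset_ftApprox hsub.mapsTo m hc) hb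
      fun i hi => ?_, fun i hi => ?_, iterate_shift_splice _ _ _⟩
    · rw [hby i hi, ← h2 i hi, iterate_shift_apply]
    · rw [splice, if_pos (by omega), h1 i hi, hax i hi]
  rcases le_or_gt M m with hMm | hMm
  · exact short M hM hMm a ha
  -- Only the last `m` letters of a long word matter.
  obtain ⟨c, hc, h1, h2⟩ := short m hm le_rfl (shift^[M - m] a)
    ((mapsTo_shift_ftApprox X m).iterate _ ha)
  refine ⟨splice (M - m) a c, splice_mem_ftApprox ha hc fun i hi => ?_, fun i hi => ?_, ?_⟩
  · rw [h1 i hi, iterate_shift_apply]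
  · rw [splice]
    split_ifs with his
    · rfl
    · rw [h1 _ (by omega), iterate_shift_apply, Nat.add_sub_cancel' (by omega)]
  · rw [show M + l = m + l + (M - m) by omega, Function.iterate_add_apply, iterate_shift_splice, h2]

theorem exists_periodic_mem_ftApprox {A : Type*} {X : Set (ℕ → A)} {m p : ℕ} (hp : 0 < p)
    (hmp : m ≤ p) {z : ℕ → A} (hz : z ∈ ftApprox X m) (h : ∀ i < m, z (p + i) = z i) :
    ∃ c ∈ ftApprox X m, shift^[p] c = c ∧ c ∈ PiNat.cylinder z (p + m) := by
  have hcz : ∀ i < p + m, z (i % p) = z i := by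
    intro i hi
    rcases lt_or_ge i p with hip | hip
    · rw [Nat.mod_eq_of_lt hip]
    · rw [Nat.mod_eq_sub_mod hip, Nat.mod_eq_of_lt (by omega), ← h _ (by omega),
        Nat.add_sub_cancel' hip]
  refine ⟨fun i => z (i % p), mem_ftApprox.2 fun j => ?_, ?_, hcz⟩
  · obtain ⟨x, hx, hzx⟩ := mem_ftApprox.1 hz (j % p)
    refine ⟨x, hx, fun i hi => ?_⟩
    have hj := Nat.mod_lt j hp
    rw [← hzx i hi, iterate_shift_apply, iterate_shift_apply, ← hcz (j % p + i) (by omega),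
      Nat.mod_add_mod]
  · funext i
    rw [iterate_shift_apply, Nat.add_mod_left]

theorem IsSpecified.hasGluing_ftApprox {A : Type*} [TopologicalSpace A] {X : Set (ℕ → A)} {l : ℕ}
    (hX : IsSpecified X l) (hsub : IsSubshift X) (hne : X.Nonempty) {m : ℕ} (hm : 1 ≤ m) :
    HasGluing (ftApprox X m) l where
  nonempty := hne.mono (subset_ftApprox hsub.mapsTo m)
  mapsTo := mapsTo_shift_ftApprox X m
  glue M N hM _ a ha b hb := by
    obtain ⟨c, hc, h1, h2⟩ := hX.exists_concat_ftApprox hsub hm hM ha hb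
    exact ⟨c, hc, h1, h2 ▸ PiNat.self_mem_cylinder _ _⟩
  close := by
    refine ⟨m, fun M N hM hN a ha b hb => ?_⟩
    -- The sequence `b(0:N) * a(0:M) * b` overlaps with itself in `N ≥ m` letters, so that it can
    -- be made periodic; the periodic sequence is then shifted to start with `a(0:M)`.
    obtain ⟨y, hy, hya, hyb⟩ := hX.exists_concat_ftApprox hsub hm hM ha hb
    obtain ⟨z, hz, hzb, hzy⟩ := hX.exists_concat_ftApprox hsub hm (hm.trans hN) hb hy
    have hy' : ∀ i, z (N + l + i) = y i := fun i => by rw [← hzy, iterate_shift_apply]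
    have hb' : ∀ i, y (M + l + i) = b i := fun i => by rw [← hyb, iterate_shift_apply]
    obtain ⟨c, hc, hper, hcz⟩ := exists_periodic_mem_ftApprox (p := N + l + (M + l)) (by omega)
      (by omega) hz fun i hi => by rw [add_assoc, hy', hb', hzb i (by omega)]
    have hper' : ∀ i, c (N + l + (M + l) + i) = c i := fun i => by
      rw [← iterate_shift_apply (N + l + (M + l)) c, hper]
    refine ⟨shift^[N + l] c, (mapsTo_shift_ftApprox X m).iterate _ hc, ?_, fun i hi => ?_,
      fun i hi => ?_⟩
    · rw [← Function.iterate_add_apply, show M + l + N + l + (N + l) =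
        N + l + (N + l + (M + l)) by omega, Function.iterate_add_apply, hper]
    · rw [iterate_shift_apply, hcz _ (by omega), hy', hya i hi]
    · rw [iterate_shift_apply, iterate_shift_apply, ← add_assoc, hper', hcz _ (by omega), hzb i hi]

/-! ### Convergence of the Gibbs measures -/

theorem tendsto_gibbs_ftApprox {A : Type*} [Finite A] [Nonempty A] [TopologicalSpace A]
    [DiscreteTopology A] [MeasurableSpace A] [BorelSpace A] {φ : (ℕ → A) → ℝ} {B D : ℝ}
    (hφ : HasBoundedDistortion φ B D) {X : Set (ℕ → A)} {l : ℕ} (hX : HasGluing X l)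
    (hXc : IsClosed X) {P : ℝ}
    (hP : ∀ N : ℕ, |Real.log (partitionFunction φ X N) - N * P| ≤ gluingConst A l B D)
    {p : ℕ → ℝ} (hp : ∀ m, 1 ≤ m → ∀ N : ℕ,
      |Real.log (partitionFunction φ (ftApprox X m) N) - N * p m| ≤ gluingConst A l B D)
    {G : ℝ} {μ : ℕ → ProbabilityMeasure (ℕ → A)} {μstar : ProbabilityMeasure (ℕ → A)}
    (hμ : ∀ m, 1 ≤ m → IsInvariantOn (ftApprox X m) (μ m) ∧
      HasGibbsBounds φ (ftApprox X m) (μ m) G (p m))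
    (hstar : IsInvariantOn X μstar) {G' : ℝ} (hstar' : HasGibbsBounds φ X μstar G' P) :
    Tendsto μ atTop (𝓝 μstar) := by
  refine tendsto_nhds_of_unique_mapClusterPt fun ν hν => ?_
  have key : IsInvariantOn X ν ∧ HasGibbsBounds φ X ν (G + 2 * gluingConst A l B D) P := by
    refine gibbs_of_mapClusterPt hXc hν ?_ ?_ ?_
    · filter_upwards [eventually_ge_atTop 1] with m hm using (hμ m hm).1.measurePreserving
    · intro w N hd
      filter_upwards [eventually_ge_atTop 1, eventually_ge_atTop N] with m hm hN
      refine measure_piNatCylinder_eq_zero (isClosed_ftApprox X m) (hμ m hm).1.full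
        fun a ha haw => ?_
      obtain ⟨x, hx, hax⟩ := exists_mem_cylinder_of_mem_ftApprox ha (show N ≤ m + 1 by omega)
      exact Set.disjoint_left.1 hd (fun i hi => (hax i hi).symm.trans (haw i hi)) hx
    · intro n a ha
      filter_upwards [eventually_ge_atTop 1, eventually_ge_atTop n] with m hm hn
      -- The partition functions of order `n + 1` of `X` and `X_m` coincide.
      have hpP : |(n + 1) * (p m - P)| ≤ 2 * gluingConst A l B D := by
        have h1 := abs_le.1 (hP (n + 1))
        have h2 := abs_le.1 (hp m hm (n + 1))
        rw [partitionFunction_ftApprox φ hX.mapsTo (by omega)] at h2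
        push_cast at h1 h2
        rw [abs_le]
        constructor <;> linarith
      have hpP := abs_le.1 hpP
      have hb := (hμ m hm).2 n a (subset_ftApprox hX.mapsTo m ha)
      refine ⟨le_trans (Real.exp_le_exp.2 ?_) hb.1, hb.2.trans (Real.exp_le_exp.2 ?_)⟩ <;> linarith
  exact hX.gibbs_unique hφ hXc hstar key.1 hstar' key.2

end FTA

theorem theorem2 {A : Type*} [Finite A] [TopologicalSpace A] [DiscreteTopology A]
    [MeasurableSpace A] [BorelSpace A] (l : ℕ) (B C θ : ℝ) :
    ∃ Cg : ℝ, 0 < Cg ∧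
      ∀ (X : Set (ℕ → A)) (φ : (ℕ → A) → ℝ),
        FTA.IsSubshift X → X.Nonempty → FTA.IsSpecified X l → FTA.IsSofic X →
        FTA.IsHolder φ C θ → (∀ a, |φ a| ≤ B) →
        ∃ (μ : ℕ → ProbabilityMeasure (ℕ → A)) (μstar : ProbabilityMeasure (ℕ → A)) (P : ℝ),
          (∀ m : ℕ, 1 ≤ m → FTA.IsGibbs φ (FTA.ftApprox X m) (μ m) ∧
            ∀ ν : ProbabilityMeasure (ℕ → A),
              FTA.IsGibbs φ (FTA.ftApprox X m) ν → ν = μ m) ∧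
          FTA.IsInvariantOn X μstar ∧
          Tendsto μ atTop (𝓝 μstar) ∧
          FTA.IsPressure φ X P ∧
          FTA.GibbsInequality φ X μstar Cg P := by
  refine ⟨Real.exp (2 * FTA.periodicConst A l B (C / (1 - θ))), Real.exp_pos _, ?_⟩
  intro X φ hsub hne hspec _ hhol hB
  have : Nonempty A := ⟨hne.some 0⟩
  have hφ := hhol.hasBoundedDistortion hB
  have hX := hspec.hasGluing hsub hne
  have hXc : IsClosed X := hsub.isCompact.isClosed
  obtain ⟨P, hP⟩ := hX.exists_pressure hφ
  obtain ⟨μstar, hinv, hgibbs⟩ := hX.exists_gibbs hφ hXc hP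
  have hXm : ∀ m, 1 ≤ m → FTA.HasGluing (FTA.ftApprox X m) l := fun m hm =>
    hspec.hasGluing_ftApprox hsub hne hm
  have hm : ∀ m : ℕ, ∃ (ν : ProbabilityMeasure (ℕ → A)) (p : ℝ), 1 ≤ m →
      (∀ N : ℕ, |Real.log (FTA.partitionFunction φ (FTA.ftApprox X m) N) - N * p| ≤
        FTA.gluingConst A l B (C / (1 - θ))) ∧
      FTA.IsInvariantOn (FTA.ftApprox X m) ν ∧ FTA.HasGibbsBounds φ (FTA.ftApprox X m) ν
        (2 * FTA.periodicConst A l B (C / (1 - θ))) p := by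
    intro m
    by_cases h : 1 ≤ m
    · obtain ⟨p, hp⟩ := (hXm m h).exists_pressure hφ
      obtain ⟨ν, hν⟩ := (hXm m h).exists_gibbs hφ (FTA.isClosed_ftApprox X m) hp
      exact ⟨ν, p, fun _ => ⟨hp, hν⟩⟩
    · exact ⟨μstar, P, fun h' => absurd h' h⟩
  choose μ p hμ using hm
  refine ⟨μ, μstar, P, fun m h => ⟨⟨(hμ m h).2.1, _, p m, Real.exp_pos _,
    (FTA.gibbsInequality_exp_iff (FTA.isClosed_ftApprox X m) (hμ m h).2.1.full).2
      (hμ m h).2.2⟩, ?_⟩, hinv, ?_, hX.isPressure hφ hP,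
    (FTA.gibbsInequality_exp_iff hXc hinv.full).2 hgibbs⟩
  · rintro ν ⟨hν, K, p', hK, hineq⟩
    rw [← Real.exp_log hK, FTA.gibbsInequality_exp_iff (FTA.isClosed_ftApprox X m) hν.full] at hineq
    exact (hXm m h).gibbs_unique hφ (FTA.isClosed_ftApprox X m) (hμ m h).2.1 hν (hμ m h).2.2 hineq
  · exact FTA.tendsto_gibbs_ftApprox hφ hX hXc hP (fun m h => (hμ m h).1)
      (fun m h => (hμ m h).2) hinv hgibbs
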